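/- Let $\mathfrak X=(X,\{R_i\}_{i=0}^3)$ be a nonsymmetric $3$-class association scheme on a finite set $X$ with $n$ elements, where $R_1^\top=R_2$ and $R_3$ is symmetric. Let $A_0,A_1,A_2,A_3$ be its adjacency matrices, and suppose that its first eigenmatrix is $$P=\begin{pmatrix} 1&\frac{k_1}{2}&\frac{k_1}{2}&k_2\\ 1&\frac12(r+bi)&\frac12(r-bi)&-(r+1)\\ 1&\frac12(r-bi)&\frac12(r+bi)&-(r+1)\\ 1&\frac{s}{2}&\frac{s}{2}&-(s+1) \end{pmatrix},$$ where $k_1$ is an even positive integer, $k_2$ is a positive integer, $r,s$ are integers, $b$ is a positive real number and $i^2=-1$; that is, $A_j=\sum_{k=0}^3P_{kj}E_k$ where $E_0=\frac1nJ$ ($J$ the all-ones matrix), $E_1,E_2,E_3$ are the primitive idempotents of the Bose--Mesner algebra, the linear span of $A_0,\dots,A_3$. Let $w_1,w_2,w_3$ be complex numbers of absolute value $1$ with $w_1\neq w_2$, and let $W=A_0+w_1A_1+w_2A_2+w_3A_3$. Then $W$ is a complex Hadamard matrix (all entries have absolute value $1$ and $W\overline{W}^\top=nI$) if and only if $$(k_1,k_2,r,s,b)=(2a(2a-1)c,\;2a-1,\;0,\;-2a,\;2a\sqrt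 c)$$ for some positive integers $a,c$, and one of the following holds. (i) $c=1$, and one of (a) $(w_1,w_2,w_3)=(w,-w,1)$ with $|w|=1$; (b) $(w_1,w_2,w_3)=(w_\pm,w_\mp,w_\pm w_\mp)$ or $(w_1,w_2,w_3)=(\overline{w_\pm},\overline{w_\mp},\overline{w_\pm w_\mp})$, where $$w_{\pm}=\frac{-(a-1)\mp a\sqrt{2a(a-1)}+\bigl(-a\pm(a-1)\sqrt{2a(a-1)}\bigr)i}{2a^2-2a+1};$$ (c) $a=2$ and $(w_1,w_2,w_3)=\bigl(\frac{3\pm4i}{5},-1,\frac{-3\mp4i}{5}\bigr)$ or $\bigl(-1,\frac{3\pm4i}{5},\frac{-3\mp4i}{5}\bigr)$. (ii) $a=1$, $c=3$, and one of (d) $(w_1,w_2,w_3)=\bigl(\frac{1\pm2\sqrt2\,i}{3},-1,1\bigr)$ or $\bigl(-1,\frac{1\pm2\sqrt2\,i}{3},1\bigr)$; (e) $(w_1,w_2,w_3)=(\pm i,-1,\mp i)$ or $(-1,\pm i,\mp i)$. In particular, $W$ is not a complex Hadamard matrix if $(r,s,b^2)=(-(k_2+1),0,(k_2+1)(k_1+k_2+1))$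 (a non-self-dual fission of a complete multipartite graph) or if $(r,s,b^2)=(-1,k_1,k_1+1)$ (a fission of a disjoint union of complete graphs). -/

import Mathlib

/-- An association scheme with `d` classes on the finite set `X`. The relations
`R_0, …, R_d` partition `X × X`, and are given by the map `color`: the pair `(x, y)` lies in
`R_i` exactly when `color x y = i`. -/
structure AssociationScheme (X : Type*) [Fintype X] (d : ℕ) where
  /-- the index of the relation that contains a given pair -/
  color : X → X → Fin (d + 1)
  /-- every relation is nonempty -/
  color_surj : ∀ i, ∃ x y, color x y = i
  /-- `R_0` is the diagonal -/
  color_eq_zero : ∀ x y, color x y = 0 ↔ x = y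
  /-- the transpose of a relation is a relation -/
  exists_transpose : ∀ i, ∃ i', ∀ x y, color x y = i ↔ color y x = i'
  /-- the intersection numbers exist -/
  exists_inter : ∀ i j k, ∃ p : ℕ, ∀ x y, color x y = k →
    (Finset.univ.filter fun z => color x z = i ∧ color z y = j).card = p

namespace AssociationScheme

variable {X : Type*} [Fintype X] {d : ℕ}

/-- The adjacency matrix `A_i`. -/
def adj (S : AssociationScheme X d) (i : Fin (d + 1)) : Matrix X X ℂ :=
  Matrix.of fun x y => if S.color x y = i then 1 else 0

/-- The linear span of the adjacency matrices (the Bose–Mesner algebra). -/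
def boseMesner (S : AssociationScheme X d) : Submodule ℂ (Matrix X X ℂ) :=
  Submodule.span ℂ (Set.range S.adj)

/-- `P` is a first eigenmatrix of the scheme: the Bose–Mesner algebra has primitive idempotents
`E_0 = (1/n) J, E_1, …, E_d` such that `A_j = ∑ k, P k j • E_k`. As the algebra has dimension
`d + 1`, a family of `d + 1` nonzero mutually orthogonal idempotents in it with sum `1` consists
of all its primitive idempotents. A scheme that has a first eigenmatrix is commutative. -/
def IsFirstEigenmatrix [DecidableEq X] (S : AssociationScheme X d)
    (P : Matrix (Fin (d + 1)) (Fin (d + 1)) ℂ) : Prop :=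
  ∃ E : Fin (d + 1) → Matrix X X ℂ,
    E 0 = (1 / (Fintype.card X : ℂ)) • Matrix.of (fun _ _ => (1 : ℂ)) ∧
    (∀ k, E k ∈ S.boseMesner) ∧
    (∀ k, E k ≠ 0) ∧
    (∀ k, E k * E k = E k) ∧
    (∀ j k, j ≠ k → E j * E k = 0) ∧
    ∑ k, E k = 1 ∧
    ∀ j, S.adj j = ∑ k, P k j • E k

end AssociationScheme

/-- A complex Hadamard matrix: all entries have absolute value `1`, and `W Wᴴ = n I`. -/
def IsComplexHadamard {X : Type*} [Fintype X] [DecidableEq X] (W : Matrix X X ℂ) : Prop :=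
  (∀ x y, ‖W x y‖ = 1) ∧ W * W.conjTranspose = (Fintype.card X : ℂ) • (1 : Matrix X X ℂ)

/-- The first eigenmatrix of a nonsymmetric 3-class scheme, in terms of its parameters. -/
noncomputable def nonsymmEigenmatrix (k₁ k₂ : ℕ) (r s : ℤ) (b : ℝ) :
    Matrix (Fin (3 + 1)) (Fin (3 + 1)) ℂ :=
  !![1, (k₁ : ℂ) / 2, (k₁ : ℂ) / 2, (k₂ : ℂ);
     1, ((r : ℂ) + (b : ℂ) * Complex.I) / 2, ((r : ℂ) - (b : ℂ) * Complex.I) / 2, -((r : ℂ) + 1);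
     1, ((r : ℂ) - (b : ℂ) * Complex.I) / 2, ((r : ℂ) + (b : ℂ) * Complex.I) / 2, -((r : ℂ) + 1);
     1, (s : ℂ) / 2, (s : ℂ) / 2, -((s : ℂ) + 1)]

/-- For `ε = 1` the number `w_+`, for `ε = -1` the number `w_-`:
`w_± = (-(a-1) ∓ a √(2a(a-1)) + (-a ± (a-1) √(2a(a-1))) i) / (2a² - 2a + 1)`. -/
noncomputable def wSign (a : ℕ) (ε : ℝ) : ℂ :=
  (((-((a : ℝ) - 1) - ε * (a * Real.sqrt (2 * a * ((a : ℝ) - 1))) : ℝ) : ℂ) +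
    ((-(a : ℝ) + ε * (((a : ℝ) - 1) * Real.sqrt (2 * a * ((a : ℝ) - 1))) : ℝ) : ℂ) * Complex.I) /
    (2 * (a : ℂ) ^ 2 - 2 * a + 1)

/-- The triples for `c = 1`. -/
def IsTripleOne (a : ℕ) (w₁ w₂ w₃ : ℂ) : Prop :=
  (∃ w : ℂ, ‖w‖ = 1 ∧ (w₁, w₂, w₃) = (w, -w, 1)) ∨
  (∃ ε : ℝ, (ε = 1 ∨ ε = -1) ∧
    ((w₁, w₂, w₃) = (wSign a ε, wSign a (-ε), wSign a ε * wSign a (-ε)) ∨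
     (w₁, w₂, w₃) = (star (wSign a ε), star (wSign a (-ε)),
        star (wSign a ε * wSign a (-ε))))) ∨
  (a = 2 ∧ ∃ ε : ℂ, (ε = 1 ∨ ε = -1) ∧
    ((w₁, w₂, w₃) = ((3 + ε * 4 * Complex.I) / 5, -1, (-3 - ε * 4 * Complex.I) / 5) ∨
     (w₁, w₂, w₃) = (-1, (3 + ε * 4 * Complex.I) / 5, (-3 - ε * 4 * Complex.I) / 5)))

/-- The triples for `a = 1`, `c = 3`. -/
def IsTripleThree (w₁ w₂ w₃ : ℂ) : Prop :=
  ∃ ε : ℂ, (ε = 1 ∨ ε = -1) ∧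
    ((w₁, w₂, w₃) = ((1 + ε * (2 * (Real.sqrt 2 : ℂ)) * Complex.I) / 3, -1, 1) ∨
     (w₁, w₂, w₃) = (-1, (1 + ε * (2 * (Real.sqrt 2 : ℂ)) * Complex.I) / 3, 1) ∨
     (w₁, w₂, w₃) = (ε * Complex.I, -1, -(ε * Complex.I)) ∨
     (w₁, w₂, w₃) = (-1, ε * Complex.I, -(ε * Complex.I)))

/-!
Write `n = 1 + k₁ + k₂`, `M = A_1 + A_2`, `N = A_1 - A_2`, `x = w₁ + w₂` and `y = w₁ - w₂`, so that
`W = I + (x / 2) M + (y / 2) N + w₃ A_3`. As `W` and `Wᴴ` lie in the Bose–Mesner algebra, `W` is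
Hadamard exactly when its four eigenvalues have absolute value `√n` (`isComplexHadamard_iff`).
Expanding these equations, and using that `y ≠ 0` is orthogonal to `x` in the plane `ℂ`, gives
three equations that are linear in `X = |x|²`, `p = Re x`, `q = Re (w₃ x̄)` and `z = Re w₃`
(`gramEquations`). Their coefficients are intersection numbers of the scheme, hence integers with
known signs.

The intersection numbers are polynomials in `r`, `s` and the even integer
`ν = 2 (p_{11}^3 - p_{12}^3)` (`isFeasible_of_nonsymmEigenmatrix`), and `r = -1`, `r ≥ 0` or
`r ≤ -2`. Together with `p² ≤ X` and `z ≥ -1` the linear equations rule out `r = -1` and `r ≥ 1`.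
For `r ≤ -2` they leave a single parameter set, on `16` points, with `A_3` the Clebsch graph. There
a Hadamard matrix would exist if the scheme did, but a local argument shows that the scheme does
not: in the set `R_1(x)` of size `5`, each point would lie on exactly one directed triangle
(`false_of_inter`).

If `r = 0`, then `A_1 + A_2` is a complete multipartite graph, and integrality of the multiplicities
gives `a` and an odd `c` (`exists_multipartite_parameters`). The inequality `p² ≤ X` then bounds `c`
(`multipartite_bound`), and in the surviving cases the linear equations, with the Gram determinant
of `1`, `w₃`, `x`, determine `w₃` and `x`, hence also `w₁` and `w₂`, since two points of the unit
circle are determined by their sum unless it is zero.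
-/

/-! ### Intersection numbers and eigenvalues of an association scheme -/

namespace AssociationScheme

variable {X : Type*} [Fintype X] {d : ℕ}

/-- The intersection number `p_{ij}^k`: the number of `z` with `(x, z) ∈ R_i` and `(z, y) ∈ R_j`,
for any pair `(x, y) ∈ R_k`. -/
noncomputable def inter (S : AssociationScheme X d) (i j k : Fin (d + 1)) : ℕ :=
  (S.exists_inter i j k).choose

lemma card_inter (S : AssociationScheme X d) (i j : Fin (d + 1)) (x y : X) :
    (Finset.univ.filter fun z => S.color x z = i ∧ S.color z y = j).card =
      S.inter i j (S.color x y) :=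
  (S.exists_inter i j (S.color x y)).choose_spec x y rfl

lemma sum_smul_adj_apply (S : AssociationScheme X d) (c : Fin (d + 1) → ℂ) (x y : X) :
    (∑ l, c l • S.adj l) x y = c (S.color x y) := by
  simp [Matrix.sum_apply, adj]

lemma adj_mul_adj (S : AssociationScheme X d) (i j : Fin (d + 1)) :
    S.adj i * S.adj j = ∑ l, (S.inter i j l : ℂ) • S.adj l := by
  ext x y
  rw [sum_smul_adj_apply, ← card_inter, Matrix.mul_apply, Finset.card_filter]
  push_cast
  refine Finset.sum_congr rfl fun z _ => ?_
  simp only [adj, Matrix.of_apply]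
  split_ifs <;> simp_all

lemma card_pos (S : AssociationScheme X d) : 0 < Fintype.card X := by
  obtain ⟨x, -, -⟩ := S.color_surj 0
  exact Fintype.card_pos_iff.mpr ⟨x⟩

variable [DecidableEq X]

lemma sum_smul_mul_of_orthogonal {E : Fin (d + 1) → Matrix X X ℂ} (hidem : ∀ k, E k * E k = E k)
    (horth : ∀ j k, j ≠ k → E j * E k = 0) (θ : Fin (d + 1) → ℂ) (k : Fin (d + 1)) :
    (∑ l, θ l • E l) * E k = θ k • E k := by
  rw [Finset.sum_mul, Finset.sum_eq_single k]
  · rw [smul_mul_assoc, hidem]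
  · intro l _ hl
    rw [smul_mul_assoc, horth l k hl, smul_zero]
  · simp

lemma adj_zero (S : AssociationScheme X d) : S.adj 0 = 1 := by
  ext x y
  simp [adj, S.color_eq_zero, Matrix.one_apply]

namespace IsFirstEigenmatrix

variable {S : AssociationScheme X d} {P : Matrix (Fin (d + 1)) (Fin (d + 1)) ℂ}

/-- The rows of the first eigenmatrix are the characters of the Bose–Mesner algebra. -/
lemma mul_eq_sum_inter (hP : S.IsFirstEigenmatrix P) (i j k : Fin (d + 1)) :
    P k i * P k j = ∑ l, (S.inter i j l : ℂ) * P k l := by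
  obtain ⟨E, -, -, hne, hidem, horth, -, hA⟩ := hP
  have hAE : ∀ j, S.adj j * E k = P k j • E k := by
    intro j
    rw [hA, sum_smul_mul_of_orthogonal hidem horth]
  have h := congrArg (· * E k) (S.adj_mul_adj i j)
  simp only [mul_assoc, hAE, mul_smul_comm, Finset.sum_mul, smul_mul_assoc, smul_smul,
    ← Finset.sum_smul] at h
  rw [mul_comm]
  exact smul_left_injective ℂ (hne k) h

/-- The first eigenmatrix is nonsingular. -/
lemma eq_zero_of_forall_sum_eq_zero (hP : S.IsFirstEigenmatrix P) {c : Fin (d + 1) → ℂ}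
    (hc : ∀ k, ∑ j, P k j * c j = 0) : c = 0 := by
  obtain ⟨E, -, -, -, -, -, -, hA⟩ := hP
  have h : ∑ j, c j • S.adj j = 0 := by
    simp_rw [hA, Finset.smul_sum, smul_smul]
    rw [Finset.sum_comm]
    simp_rw [← Finset.sum_smul, mul_comm (c _), hc]
    simp
  funext l
  obtain ⟨x, y, rfl⟩ := S.color_surj l
  rw [← sum_smul_adj_apply S c x y, h]
  rfl

/-- The entries in the row of the trivial idempotent are the valencies. -/
lemma card_color_eq (hP : S.IsFirstEigenmatrix P) (j : Fin (d + 1)) (x : X) :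
    ((Finset.univ.filter fun z => S.color x z = j).card : ℂ) = P 0 j := by
  obtain ⟨E, h0, -, hne, hidem, horth, -, hA⟩ := hP
  have hAE : S.adj j * E 0 = P 0 j • E 0 := by
    rw [hA, sum_smul_mul_of_orthogonal hidem horth]
  have hn : (Fintype.card X : ℂ) ≠ 0 := by exact_mod_cast S.card_pos.ne'
  have h := congrFun (congrFun hAE x) x
  rw [h0, mul_smul_comm, smul_comm, Matrix.smul_apply, Matrix.smul_apply] at h
  have h' := mul_left_cancel₀ (one_div_ne_zero hn) h
  simpa [Matrix.mul_apply, adj] using h'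

lemma card_eq_sum (hP : S.IsFirstEigenmatrix P) : (Fintype.card X : ℂ) = ∑ j, P 0 j := by
  obtain ⟨x, -, -⟩ := S.color_surj 0
  simp_rw [← hP.card_color_eq _ x]
  rw [← Finset.card_univ, Finset.card_eq_sum_card_fiberwise (f := S.color x) (t := Finset.univ)
    (fun _ _ => Finset.mem_coe.mpr (Finset.mem_univ _))]
  push_cast
  rfl

/-- The traces of the primitive idempotents, which are the ranks of these idempotents, are natural
numbers. -/
lemma exists_multiplicities (hP : S.IsFirstEigenmatrix P) :
    ∃ m : Fin (d + 1) → ℕ, m 0 = 1 ∧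
      ∀ j, ∑ k, P k j * m k = if j = 0 then (Fintype.card X : ℂ) else 0 := by
  obtain ⟨E, h0, -, -, hidem, -, -, hA⟩ := hP
  have htr : ∀ k, ∃ m : ℕ, (E k).trace = m := by
    intro k
    have hproj : IsIdempotentElem (Matrix.toLin' (E k)) := by
      rw [IsIdempotentElem, Module.End.mul_eq_comp, ← Matrix.toLin'_mul, hidem]
    refine ⟨Module.finrank ℂ (LinearMap.range (Matrix.toLin' (E k))), ?_⟩
    rw [← Matrix.trace_toLin'_eq]
    exact (LinearMap.IsIdempotentElem.isProj_range _ hproj).trace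
  choose m hm using htr
  have hn : (Fintype.card X : ℂ) ≠ 0 := by exact_mod_cast S.card_pos.ne'
  refine ⟨m, ?_, fun j => ?_⟩
  · have := hm 0
    rw [h0] at this
    have h1 : (m 0 : ℂ) = 1 := by
      rw [← this]
      simp [Matrix.trace, hn]
    exact_mod_cast h1
  · have h := congrArg Matrix.trace (hA j)
    rw [Matrix.trace_sum] at h
    simp only [Matrix.trace_smul, hm, smul_eq_mul] at h
    rw [← h]
    split_ifs with hj
    · rw [hj, adj_zero, Matrix.trace_one]
    · refine Finset.sum_eq_zero fun x _ => ?_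
      have : S.color x x ≠ j := fun hx => hj (hx ▸ (S.color_eq_zero x x).mpr rfl)
      simp [adj, this]

/-- A product of two elements of the Bose–Mesner algebra is scalar exactly when the products of
their eigenvalues are all equal to that scalar. -/
lemma mul_eq_smul_one_iff (hP : S.IsFirstEigenmatrix P) (c e : Fin (d + 1) → ℂ) (μ : ℂ) :
    (∑ i, c i • S.adj i) * (∑ i, e i • S.adj i) = μ • 1 ↔
      ∀ k, (∑ i, c i * P k i) * (∑ i, e i * P k i) = μ := by
  obtain ⟨E, -, -, hne, hidem, horth, hsum, hA⟩ := hP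
  have hW : ∀ c : Fin (d + 1) → ℂ, ∑ i, c i • S.adj i = ∑ k, (∑ i, c i * P k i) • E k := by
    intro c
    simp_rw [hA, Finset.smul_sum, smul_smul]
    rw [Finset.sum_comm]
    simp_rw [← Finset.sum_smul]
  have hWE (θ : Fin (d + 1) → ℂ) k := sum_smul_mul_of_orthogonal hidem horth θ k
  rw [hW c, hW e]
  constructor
  · intro h k
    have h' := congrArg (· * E k) h
    simp only [mul_assoc, hWE, mul_smul_comm, smul_mul_assoc, one_mul, smul_smul] at h'
    rw [mul_comm]
    exact smul_left_injective ℂ (hne k) h'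
  · intro h
    rw [← hsum, Finset.mul_sum, Finset.smul_sum]
    refine Finset.sum_congr rfl fun k _ => ?_
    rw [mul_smul_comm, hWE, smul_smul, mul_comm, h]

end IsFirstEigenmatrix

end AssociationScheme

/-! ### Parameters of nonsymmetric 3-class schemes -/

namespace AssociationScheme

/-- Necessary conditions on the parameters of a nonsymmetric 3-class scheme. The integer `ν` is
`2 (p_{11}^3 - p_{12}^3)`, the entry of `(A_1 - A_2)^2` at the pairs in `R_3`. -/
structure IsFeasible (k₁ k₂ r s ν : ℤ) (b : ℝ) : Prop where
  k₁_pos : 0 < k₁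
  k₂_pos : 0 < k₂
  even_ν : Even ν
  k₁_eq : k₁ = -(1 + s) * ν - r * s
  ν_mul_k₂ : ν * k₂ = k₁ * (r + 1)
  b_sq : b ^ 2 = k₁ + r ^ 2 + ν * (r + 1)
  r_ne_s : r ≠ s
  /-- `p_{33}^1 ≥ 0` -/
  inter_331_nonneg : 0 ≤ k₂ + (r + 1) * (s + 1)
  /-- `p_{33}^3 ≥ 0` -/
  inter_333_nonneg : 0 ≤ k₂ - 1 + r * s
  /-- `p_{13}^2 ≥ 0` -/
  inter_132_nonneg : (1 + r) * s ≤ 0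
  /-- `p_{13}^1 ≥ 0` -/
  inter_131_nonneg : (1 + r) * (2 + s) ≤ 0
  /-- the right operand is `4 p_{11}^2` -/
  four_dvd : 4 ∣ k₁ + r * s - 2 * r + s
  /-- `p_{11}^2 ≥ 0` -/
  inter_112_nonneg : 0 ≤ k₁ + r * s - 2 * r + s

variable {X : Type*} [Fintype X] {S : AssociationScheme X 3}
  {k₁ k₂ : ℕ} {r s : ℤ} {b : ℝ}

lemma inter_zero_of_color_swap {i j i' : Fin 4} (hi : ∀ x y, S.color x y = i ↔ S.color y x = i')
    (hij : i' ≠ j) : S.inter i j 0 = 0 := by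
  obtain ⟨x, -, -⟩ := S.color_surj 0
  rw [← (S.color_eq_zero x x).mpr rfl, ← card_inter, Finset.card_eq_zero,
    Finset.filter_eq_empty_iff]
  rintro z - ⟨h1, h2⟩
  exact hij (((hi x z).mp h1).symm.trans h2)

variable [DecidableEq X]

lemma card_eq_of_nonsymmEigenmatrix
    (hP : S.IsFirstEigenmatrix (nonsymmEigenmatrix k₁ k₂ r s b)) :
    Fintype.card X = 1 + k₁ + k₂ := by
  have h := hP.card_eq_sum
  simp [nonsymmEigenmatrix, Fin.sum_univ_four] at h
  have : (Fintype.card X : ℂ) = 1 + k₁ + k₂ := by rw [h]; ring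
  exact_mod_cast this

lemma k₂_pos_of_nonsymmEigenmatrix
    (hP : S.IsFirstEigenmatrix (nonsymmEigenmatrix k₁ k₂ r s b)) : 0 < k₂ := by
  obtain ⟨x, y, hxy⟩ := S.color_surj 3
  have h := hP.card_color_eq 3 x
  simp only [nonsymmEigenmatrix] at h
  have h' : (Finset.univ.filter fun z => S.color x z = 3).card = k₂ := by
    have : (((Finset.univ.filter fun z => S.color x z = 3).card : ℕ) : ℂ) = k₂ := by
      rw [h]; simp
    exact_mod_cast this
  rw [← h']
  exact Finset.card_pos.mpr ⟨y, by simpa using hxy⟩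

lemma r_ne_s_of_nonsymmEigenmatrix
    (hP : S.IsFirstEigenmatrix (nonsymmEigenmatrix k₁ k₂ r s b)) : r ≠ s := by
  rintro rfl
  -- If `r = s`, the cross product of `(1, k₁, k₂)` and `(1, r, -(r + 1))` gives a vector in the
  -- kernel of the eigenmatrix.
  have h := hP.eq_zero_of_forall_sum_eq_zero
    (c := ![-(k₁ : ℂ) * (r + 1) - k₂ * r, k₂ + r + 1, k₂ + r + 1, r - k₁]) (by
      intro k
      fin_cases k <;> simp [nonsymmEigenmatrix, Fin.sum_univ_four] <;> ring)
  have h1 : (k₂ : ℂ) + r + 1 = 0 := by simpa using congrFun h 1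
  have h3 : (r : ℂ) - k₁ = 0 := by simpa using congrFun h 3
  have h1' : (k₂ : ℤ) + r + 1 = 0 := by exact_mod_cast h1
  have h3' : r - (k₁ : ℤ) = 0 := by exact_mod_cast h3
  omega

/-- The coefficient of `A_0` in `A_i A_iᵀ` is the valency of `R_i`. -/
lemma inter_zero_of_transpose {P : Matrix (Fin 4) (Fin 4) ℂ} (hP : S.IsFirstEigenmatrix P)
    {i i' : Fin 4} (hi : ∀ x y, S.color x y = i ↔ S.color y x = i') :
    (S.inter i i' 0 : ℂ) = P 0 i := by
  obtain ⟨x, -, -⟩ := S.color_surj 0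
  rw [← hP.card_color_eq i x, ← (S.color_eq_zero x x).mpr rfl, ← card_inter]
  congr 2
  ext z
  simp only [Finset.mem_filter, Finset.mem_univ, true_and, ← hi x z, and_self]

theorem isFeasible_of_nonsymmEigenmatrix (h₁₂ : ∀ x y, S.color x y = 1 ↔ S.color y x = 2)
    (h₃ : ∀ x y, S.color x y = 3 ↔ S.color y x = 3) (hk₁ : 0 < k₁) (hb : 0 < b)
    (hP : S.IsFirstEigenmatrix (nonsymmEigenmatrix k₁ k₂ r s b)) :
    ∃ ν : ℤ, IsFeasible k₁ k₂ r s ν b := by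
  have hk₂ := k₂_pos_of_nonsymmEigenmatrix hP
  have hrs := r_ne_s_of_nonsymmEigenmatrix hP
  have p11 : (S.inter 1 1 0 : ℝ) = 0 := by
    exact_mod_cast inter_zero_of_color_swap h₁₂ (by decide)
  have p13 : (S.inter 1 3 0 : ℝ) = 0 := by
    exact_mod_cast inter_zero_of_color_swap h₁₂ (by decide)
  have p12 : (S.inter 1 2 0 : ℝ) = k₁ / 2 := by
    simpa [nonsymmEigenmatrix] using congrArg Complex.re (inter_zero_of_transpose hP h₁₂)
  have p33 : (S.inter 3 3 0 : ℝ) = k₂ := by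
    simpa [nonsymmEigenmatrix] using congrArg Complex.re (inter_zero_of_transpose hP h₃)
  have a0 := congrArg Complex.re (hP.mul_eq_sum_inter 1 1 0)
  have a1 := congrArg Complex.re (hP.mul_eq_sum_inter 1 1 1)
  have a1' := congrArg Complex.im (hP.mul_eq_sum_inter 1 1 1)
  have a3 := congrArg Complex.re (hP.mul_eq_sum_inter 1 1 3)
  have b0 := congrArg Complex.re (hP.mul_eq_sum_inter 1 2 0)
  have b1 := congrArg Complex.re (hP.mul_eq_sum_inter 1 2 1)
  have b1' := congrArg Complex.im (hP.mul_eq_sum_inter 1 2 1)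
  have b3 := congrArg Complex.re (hP.mul_eq_sum_inter 1 2 3)
  have c0 := congrArg Complex.re (hP.mul_eq_sum_inter 1 3 0)
  have c1 := congrArg Complex.re (hP.mul_eq_sum_inter 1 3 1)
  have c1' := congrArg Complex.im (hP.mul_eq_sum_inter 1 3 1)
  have c3 := congrArg Complex.re (hP.mul_eq_sum_inter 1 3 3)
  have d1 := congrArg Complex.re (hP.mul_eq_sum_inter 3 3 1)
  have d1' := congrArg Complex.im (hP.mul_eq_sum_inter 3 3 1)
  have d3 := congrArg Complex.re (hP.mul_eq_sum_inter 3 3 3)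
  simp [nonsymmEigenmatrix, Fin.sum_univ_four, p11, p12, p13, p33]
    at a0 a1 a1' a3 b0 b1 b1' b3 c0 c1 c1' c3 d1 d1' d3
  generalize S.inter 1 1 1 = α at *
  generalize S.inter 1 1 2 = β at *
  generalize S.inter 1 1 3 = δ at *
  generalize S.inter 1 2 1 = α₁ at *
  generalize S.inter 1 2 2 = α₂ at *
  generalize S.inter 1 2 3 = ε at *
  generalize S.inter 1 3 1 = γ₁ at *
  generalize S.inter 1 3 2 = γ₂ at *
  generalize S.inter 1 3 3 = m at *
  generalize S.inter 3 3 1 = l₁ at *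
  generalize S.inter 3 3 2 = l₂ at *
  generalize S.inter 3 3 3 = t at *
  have hb2 : b / 2 ≠ 0 := by positivity
  have hrs' : (r : ℝ) - s ≠ 0 := sub_ne_zero.mpr (by exact_mod_cast hrs)
  have hK : (0 : ℝ) < k₁ := by exact_mod_cast hk₁
  have hL : (0 : ℝ) < k₂ := by exact_mod_cast hk₂
  -- the imaginary parts of the eigenvalues at `E_1`
  have hαβ : (α : ℝ) - β = r := by
    apply mul_left_cancel₀ hb2; linear_combination -a1'
  have hα : (α₁ : ℝ) = α₂ := by
    apply mul_left_cancel₀ hb2; linear_combination -b1'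
  have hγ : (γ₁ : ℝ) - γ₂ = -(r + 1) := by
    apply mul_left_cancel₀ hb2; linear_combination -c1'
  have hl : (l₁ : ℝ) = l₂ := by
    apply mul_left_cancel₀ hb2; linear_combination -d1'
  -- eliminating between the eigenspaces for `r` and `s` gives the symmetrized coefficients
  have hh : (γ₁ : ℝ) + γ₂ = -(r + 1) * (s + 1) := by
    apply mul_left_cancel₀ hrs'
    linear_combination 2 * (r + 1) * c3 - 2 * (s + 1) * c1
  have hm : (2 * m : ℝ) = -r * s := by
    apply mul_left_cancel₀ hrs'
    linear_combination 2 * r * c3 - 2 * s * c1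
  have hlt : (l₁ : ℝ) - t = r + s + 2 := by
    apply mul_left_cancel₀ hrs'
    linear_combination d3 - d1 + (r - s) / 2 * hl
  have hl₁ : (l₁ : ℝ) = k₂ + (r + 1) * (s + 1) := by
    linear_combination d1 - r / 2 * hl + (r + 1) * hlt
  -- the determinant of the equations that the next step solves
  have hD : (k₁ : ℝ) * (s + 1) + k₂ * s ≠ 0 := by
    intro hD
    have hs : (s : ℝ) = k₁ := by
      apply mul_left_cancel₀ hL.ne'
      linear_combination -2 * c0 + (r + 1) * hD - k₁ * hh - k₂ * hm
    rw [hs] at hD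
    have : 0 < (k₁ : ℝ) * (k₁ + 1) + k₂ * k₁ := by positivity
    exact this.ne' hD
  -- `A_1^2 - A_1 A_2` and `A_1^2 + A_1 A_2` at the rational eigenspaces
  have hω : (α : ℝ) + β - 2 * α₁ = -r := by
    apply mul_left_cancel₀ hD
    linear_combination -2 * (s + 1) * (a0 - b0) - 2 * k₂ * (a3 - b3) + 2 * c0 + k₁ * hh + k₂ * hm
      - (k₁ * (s + 1) + k₂ * s) * hα
  have hlam : (α : ℝ) + β + 2 * α₁ - 2 * (δ + ε) = r + s := by
    apply mul_left_cancel₀ hrs'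
    linear_combination 2 * (a3 + b3) - 2 * (a1 + b1) + (r - s) * hα
  have hμ : 2 * (δ + ε) = (k₁ : ℝ) + r * s := by
    linear_combination 2 * (a1 + b1) + r * hlam - r * hα
  have hβ : 4 * (β : ℝ) = k₁ + r * s - 2 * r + s := by
    linear_combination hω + hlam + hμ - 2 * hαβ
  have hν : (k₁ : ℝ) = -(1 + s) * (2 * (δ - ε)) - r * s := by
    linear_combination 2 * (a3 - b3) + s * hω + s * hα
  have hνk : 2 * (δ - ε) * (k₂ : ℝ) = k₁ * (r + 1) := by
    linear_combination -2 * (a0 - b0) - k₁ * hω - k₁ * hα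
  have hb_sq : b ^ 2 = k₁ + r ^ 2 + 2 * (δ - ε) * (r + 1) := by
    linear_combination -2 * (a1 - b1) - r * hω - r * hα
  have ht : (t : ℝ) = k₂ - 1 + r * s := by linear_combination hl₁ - hlt
  have hγ₂ : (2 * γ₂ : ℝ) = -((1 + r) * s) := by linear_combination hh - hγ
  have hγ₁ : (2 * γ₁ : ℝ) = -((1 + r) * (2 + s)) := by linear_combination hh + hγ
  have hβ' : 4 * (β : ℤ) = k₁ + r * s - 2 * r + s := by exact_mod_cast hβ
  have ht' : (t : ℤ) = k₂ - 1 + r * s := by exact_mod_cast ht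
  have hl₁' : (l₁ : ℤ) = k₂ + (r + 1) * (s + 1) := by exact_mod_cast hl₁
  have hγ₂' : (2 * γ₂ : ℤ) = -((1 + r) * s) := by exact_mod_cast hγ₂
  have hγ₁' : (2 * γ₁ : ℤ) = -((1 + r) * (2 + s)) := by exact_mod_cast hγ₁
  exact ⟨2 * (δ - ε),
    { k₁_pos := by exact_mod_cast hk₁
      k₂_pos := by exact_mod_cast hk₂
      even_ν := even_two_mul _
      k₁_eq := by exact_mod_cast hν
      ν_mul_k₂ := by exact_mod_cast hνk
      b_sq := by push_cast; exact hb_sq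
      r_ne_s := hrs
      inter_331_nonneg := by omega
      inter_333_nonneg := by omega
      inter_132_nonneg := by omega
      inter_131_nonneg := by omega
      four_dvd := ⟨β, hβ'.symm⟩
      inter_112_nonneg := by omega }⟩

end AssociationScheme

/-! ### Nonexistence of the scheme with parameters of the Clebsch graph -/

namespace AssociationScheme

variable {X : Type*} [Fintype X]

/-- With these intersection numbers, every point of the `5`-set `R_1(x)` would lie on a unique
directed `3`-cycle of `R_1` inside `R_1(x)`. -/
theorem false_of_inter (S : AssociationScheme X 3)
    (h₁₂ : ∀ x y, S.color x y = 1 ↔ S.color y x = 2)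
    (hcard : ∀ x, (Finset.univ.filter fun z => S.color x z = 1).card = 5)
    (h112 : S.inter 1 1 2 = 3) (h121 : S.inter 1 2 1 = 1) (h211 : S.inter 2 1 1 = 1)
    (h321 : S.inter 3 2 1 = 1) : False := by
  classical
  obtain ⟨x, -, -⟩ := S.color_surj 0
  -- the unique out-neighbour of a point of `R_1(x)` in `R_1(x)`
  have hout : ∀ y, S.color x y = 1 → ∃ z, S.color x z = 1 ∧ S.color y z = 1 ∧
      ∀ z', S.color x z' = 1 → S.color y z' = 1 → z' = z := by
    intro y hy
    have h := S.card_inter 1 2 x y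
    rw [hy, h121, Finset.card_eq_one] at h
    obtain ⟨z, hz⟩ := h
    have hmem : ∀ z', (S.color x z' = 1 ∧ S.color y z' = 1) ↔ z' = z := by
      intro z'
      rw [h₁₂ y z']
      simpa using (Finset.ext_iff.mp hz) z'
    exact ⟨z, ((hmem z).mpr rfl).1, ((hmem z).mpr rfl).2, fun z' h1 h2 => (hmem z').mp ⟨h1, h2⟩⟩
  choose! f hf₁ hf₂ hf₃ using hout
  have hcycle : ∀ y, S.color x y = 1 → f (f (f y)) = y := by
    intro y hy
    -- `R_1(f y) ∩ R_2(y)` has `3` points, at most one of which is in each of `R_2(x)`, `R_3(x)`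
    have hc := S.card_inter 1 1 (f y) y
    rw [(h₁₂ y (f y)).mp (hf₂ y hy), h112] at hc
    have h2 := S.card_inter 2 1 x y
    rw [hy, h211] at h2
    have h3 := S.card_inter 3 2 x (f y)
    rw [hf₁ y hy, h321] at h3
    have hex : ∃ z, (S.color (f y) z = 1 ∧ S.color z y = 1) ∧ S.color x z = 1 := by
      by_contra! hno
      have hsub : (Finset.univ.filter fun z => S.color (f y) z = 1 ∧ S.color z y = 1) ⊆
          (Finset.univ.filter fun z => S.color x z = 2 ∧ S.color z y = 1) ∪
          (Finset.univ.filter fun z => S.color x z = 3 ∧ S.color z (f y) = 2) := by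
        intro z hz
        simp only [Finset.mem_filter, Finset.mem_univ, true_and, Finset.mem_union] at hz ⊢
        have h1 := hno z hz
        have h0 : S.color x z ≠ 0 := by
          intro h0
          rw [S.color_eq_zero] at h0
          have h := (h₁₂ _ _).mp hz.1
          rw [← h0, hf₁ y hy] at h
          exact absurd h (by decide)
        have h4 : ∀ c : Fin 4, c ≠ 0 → c ≠ 1 → c = 2 ∨ c = 3 := by decide
        rcases h4 _ h0 h1 with h | h
        · exact Or.inl ⟨h, hz.2⟩
        · exact Or.inr ⟨h, (h₁₂ _ _).mp hz.1⟩
      have := (Finset.card_le_card hsub).trans (Finset.card_union_le _ _)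
      omega
    obtain ⟨z, ⟨hz1, hz2⟩, hz3⟩ := hex
    have e1 : z = f (f y) := hf₃ (f y) (hf₁ y hy) z hz3 hz1
    have e2 : y = f z := hf₃ z hz3 y hy hz2
    rw [← e1, ← e2]
  -- `f` is a permutation of order `3` without fixed points
  let g : Function.End {y // S.color x y = 1} := fun y => ⟨f y, hf₁ y y.2⟩
  have hg : g ^ 3 ^ 1 = 1 := by
    funext y
    exact Subtype.ext (hcycle y y.2)
  have hfix := Equiv.Perm.card_fixedPoints_modEq hg
  have hempty : Fintype.card (Function.fixedPoints g) = 0 := by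
    rw [Fintype.card_eq_zero_iff]
    constructor
    rintro ⟨y, hy⟩
    have h1 : f y = y := congrArg Subtype.val hy
    have h2 := hf₂ y y.2
    rw [h1, (S.color_eq_zero _ _).mpr rfl] at h2
    exact absurd h2 (by decide)
  have hcard' : Fintype.card {y // S.color x y = 1} = 5 := by
    rw [Fintype.card_subtype, hcard]
  rw [hempty, hcard'] at hfix
  exact absurd hfix (by decide)

variable [DecidableEq X]

/-- The parameters `(k₁, k₂, r, s, b) = (10, 5, -2, 2, 4)` pass all arithmetic conditions, but no such
scheme exists. -/
theorem not_isFirstEigenmatrix_clebsch (S : AssociationScheme X 3)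
    (h₁₂ : ∀ x y, S.color x y = 1 ↔ S.color y x = 2) :
    ¬ S.IsFirstEigenmatrix (nonsymmEigenmatrix 10 5 (-2) 2 4) := by
  intro hP
  have hcard : ∀ x, (Finset.univ.filter fun z => S.color x z = 1).card = 5 := by
    intro x
    have h := hP.card_color_eq 1 x
    have h' : (((Finset.univ.filter fun z => S.color x z = 1).card : ℕ) : ℂ) = 5 := by
      rw [h]; norm_num [nonsymmEigenmatrix]
    exact_mod_cast h'
  -- the eigenvalues `u` of `A_i A_j` determine its coefficients
  have key : ∀ i j : Fin 4, ∀ u₀ u₁ v₁ u₃ : ℝ,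
      (nonsymmEigenmatrix 10 5 (-2) 2 4 0 i * nonsymmEigenmatrix 10 5 (-2) 2 4 0 j).re = u₀ →
      (nonsymmEigenmatrix 10 5 (-2) 2 4 1 i * nonsymmEigenmatrix 10 5 (-2) 2 4 1 j).re = u₁ →
      (nonsymmEigenmatrix 10 5 (-2) 2 4 1 i * nonsymmEigenmatrix 10 5 (-2) 2 4 1 j).im = v₁ →
      (nonsymmEigenmatrix 10 5 (-2) 2 4 3 i * nonsymmEigenmatrix 10 5 (-2) 2 4 3 j).re = u₃ →
      16 * (S.inter i j 1 : ℝ) = u₀ - 2 * u₁ + 4 * v₁ + u₃ ∧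
      16 * (S.inter i j 2 : ℝ) = u₀ - 2 * u₁ - 4 * v₁ + u₃ := by
    intro i j u₀ u₁ v₁ u₃ h0 h1 h1' h3
    rw [hP.mul_eq_sum_inter] at h0 h1 h1' h3
    simp [nonsymmEigenmatrix, Fin.sum_univ_four] at h0 h1 h1' h3
    constructor <;> linarith
  have k11 := (key 1 1 _ _ _ _ rfl rfl rfl rfl).2
  have k12 := (key 1 2 _ _ _ _ rfl rfl rfl rfl).1
  have k21 := (key 2 1 _ _ _ _ rfl rfl rfl rfl).1
  have k32 := (key 3 2 _ _ _ _ rfl rfl rfl rfl).1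
  simp [nonsymmEigenmatrix] at k11 k12 k21 k32
  refine false_of_inter S h₁₂ hcard ?_ ?_ ?_ ?_
  · have : (S.inter 1 1 2 : ℝ) = 3 := by linarith
    exact_mod_cast this
  · have : (S.inter 1 2 1 : ℝ) = 1 := by linarith
    exact_mod_cast this
  · have : (S.inter 2 1 1 : ℝ) = 1 := by linarith
    exact_mod_cast this
  · have : (S.inter 3 2 1 : ℝ) = 1 := by linarith
    exact_mod_cast this

end AssociationScheme

/-! ### The Hadamard property in terms of the parameters -/

namespace AssociationScheme

variable {X : Type*} [Fintype X] [DecidableEq X] {S : AssociationScheme X 3}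
  {k₁ k₂ : ℕ} {r s : ℤ} {b : ℝ} {w₁ w₂ w₃ : ℂ}

/-- The equations `|θ_k|^2 = n` for the four eigenvalues `θ_k` of `W`, in real coordinates. They
involve `w₁` and `w₂` only through `x = w₁ + w₂` and `y = w₁ - w₂`. -/
def EigenvalueEquations (k₁ k₂ r s b : ℝ) (x y w : ℂ) : Prop :=
  (1 + k₁ / 2 * x.re + k₂ * w.re) ^ 2 + (k₁ / 2 * x.im + k₂ * w.im) ^ 2 = 1 + k₁ + k₂ ∧
  (1 + r / 2 * x.re - b / 2 * y.im - (r + 1) * w.re) ^ 2 +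
    (r / 2 * x.im + b / 2 * y.re - (r + 1) * w.im) ^ 2 = 1 + k₁ + k₂ ∧
  (1 + r / 2 * x.re + b / 2 * y.im - (r + 1) * w.re) ^ 2 +
    (r / 2 * x.im - b / 2 * y.re - (r + 1) * w.im) ^ 2 = 1 + k₁ + k₂ ∧
  (1 + s / 2 * x.re - (s + 1) * w.re) ^ 2 + (s / 2 * x.im - (s + 1) * w.im) ^ 2 = 1 + k₁ + k₂

theorem isComplexHadamard_iff (h₁₂ : ∀ x y, S.color x y = 1 ↔ S.color y x = 2)
    (h₃ : ∀ x y, S.color x y = 3 ↔ S.color y x = 3)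
    (hP : S.IsFirstEigenmatrix (nonsymmEigenmatrix k₁ k₂ r s b))
    (hw₁ : ‖w₁‖ = 1) (hw₂ : ‖w₂‖ = 1) (hw₃ : ‖w₃‖ = 1) :
    IsComplexHadamard (S.adj 0 + w₁ • S.adj 1 + w₂ • S.adj 2 + w₃ • S.adj 3) ↔
      EigenvalueEquations k₁ k₂ r s b (w₁ + w₂) (w₁ - w₂) w₃ := by
  have hW : S.adj 0 + w₁ • S.adj 1 + w₂ • S.adj 2 + w₃ • S.adj 3 =
      ∑ i, ![1, w₁, w₂, w₃] i • S.adj i := by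
    simp [Fin.sum_univ_four]
  have hnorm : ∀ x y, ‖(S.adj 0 + w₁ • S.adj 1 + w₂ • S.adj 2 + w₃ • S.adj 3) x y‖ = 1 := by
    intro x y
    rw [hW, sum_smul_adj_apply]
    have h : ∀ c, ‖![1, w₁, w₂, w₃] c‖ = 1 := by
      intro c
      fin_cases c <;> simp [hw₁, hw₂, hw₃]
    exact h _
  have hT : ∀ i i', (∀ x y, S.color x y = i ↔ S.color y x = i') →
      (S.adj i).conjTranspose = S.adj i' := by
    intro i i' h
    ext x y
    simp only [Matrix.conjTranspose_apply, adj, Matrix.of_apply, ← h y x]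
    split_ifs <;> simp
  have hW' : (S.adj 0 + w₁ • S.adj 1 + w₂ • S.adj 2 + w₃ • S.adj 3).conjTranspose =
      ∑ i, ![1, star w₂, star w₁, star w₃] i • S.adj i := by
    simp only [Matrix.conjTranspose_add, Matrix.conjTranspose_smul, hT 1 2 h₁₂,
      hT 2 1 (fun x y => (h₁₂ y x).symm), hT 3 3 h₃, adj_zero, Matrix.conjTranspose_one,
      Fin.sum_univ_four]
    simp
    abel
  have hn : (Fintype.card X : ℂ) = ((1 + k₁ + k₂ : ℝ) : ℂ) := by
    rw [card_eq_of_nonsymmEigenmatrix hP]; push_cast; rfl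
  rw [IsComplexHadamard, and_iff_right hnorm, hW', hW, hP.mul_eq_smul_one_iff, hn,
    EigenvalueEquations]
  have heq : ∀ (θ : ℂ) (t : ℝ), θ * star θ = t ↔ θ.re ^ 2 + θ.im ^ 2 = t := by
    intro θ t
    rw [Complex.star_def, Complex.mul_conj, Complex.normSq_apply, Complex.ofReal_inj, sq, sq]
  have hθ : ∀ k, ∑ i, ![1, star w₂, star w₁, star w₃] i * nonsymmEigenmatrix k₁ k₂ r s b k i =
      star (∑ i, ![1, w₁, w₂, w₃] i * nonsymmEigenmatrix k₁ k₂ r s b k i) := by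
    intro k
    fin_cases k <;> simp [nonsymmEigenmatrix, Fin.sum_univ_four] <;> ring
  simp_rw [hθ, heq]
  rw [Fin.forall_fin_succ, Fin.forall_fin_succ, Fin.forall_fin_succ, Fin.forall_fin_one]
  simp [nonsymmEigenmatrix, Fin.sum_univ_four]
  refine and_congr ?_ (and_congr ?_ (and_congr ?_ ?_)) <;> ring_nf

end AssociationScheme

/-- The consequences of the equations `|θ_k|^2 = n` for the Gram matrix of `1`, `w` and
`x = w₁ + w₂`: the entries `X = |x|^2`, `p = Re x`, `q = Re (w conj x)` and `z = Re w` satisfy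
three linear equations. -/
structure GramEquations (k₁ k₂ r s ν X p q z : ℝ) : Prop where
  p_eq : p = (r + 1) * q - r / 2 * X
  /-- the coefficient of `A_1 + A_2` in `W Wᴴ` -/
  coeff_one : X * (k₁ + r * s - 2 * r + s) / 4 + r + (k₂ + (1 + r) * (1 + s)) - q * (1 + r) * s = 0
  /-- the coefficient of `A_3` in `W Wᴴ` -/
  coeff_three : -(X * ν * s) / 4 - ν + (k₂ - 1 + r * s) + 2 * z - q * r * s = 0

open AssociationScheme in
/-- The formula for `p` says that `W Wᴴ` has no component along `A_1 - A_2`. Then `W Wᴴ - n I` is a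
combination of `A_1 + A_2` and `A_3`, whose coefficients vanish because its eigenvalues at
`E_1 + E_2` and `E_3` do. -/
theorem gramEquations {k₁ k₂ r s ν : ℤ} {b : ℝ} (hb : 0 < b) (hF : IsFeasible k₁ k₂ r s ν b)
    {w₁ w₂ w : ℂ} (hw₁ : ‖w₁‖ = 1) (hw₂ : ‖w₂‖ = 1) (hw : ‖w‖ = 1) (hne : w₁ ≠ w₂)
    (h : EigenvalueEquations k₁ k₂ r s b (w₁ + w₂) (w₁ - w₂) w) :
    GramEquations k₁ k₂ r s ν ((w₁ + w₂).re ^ 2 + (w₁ + w₂).im ^ 2) (w₁ + w₂).re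
      (w.re * (w₁ + w₂).re + w.im * (w₁ + w₂).im) w.re := by
  have hsq : ∀ {v : ℂ}, ‖v‖ = 1 → v.re ^ 2 + v.im ^ 2 = 1 := by
    intro v hv
    rw [sq, sq, ← Complex.normSq_apply, Complex.normSq_eq_norm_sq, hv, one_pow]
  replace hw₁ := hsq hw₁
  replace hw₂ := hsq hw₂
  replace hw := hsq hw
  have horth : (w₁ + w₂).re * (w₁ - w₂).re + (w₁ + w₂).im * (w₁ - w₂).im = 0 := by
    simp; linear_combination hw₁ - hw₂
  have hsum : (w₁ + w₂).re ^ 2 + (w₁ + w₂).im ^ 2 + ((w₁ - w₂).re ^ 2 + (w₁ - w₂).im ^ 2) = 4 := by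
    simp; linear_combination 2 * hw₁ + 2 * hw₂
  have hy : (w₁ - w₂).re ≠ 0 ∨ (w₁ - w₂).im ≠ 0 := by
    by_contra! h0
    exact hne (sub_eq_zero.mp (Complex.ext h0.1 h0.2))
  generalize w₁ + w₂ = x at *
  generalize w₁ - w₂ = y at *
  obtain ⟨x₁, x₂⟩ := x
  obtain ⟨y₁, y₂⟩ := y
  obtain ⟨z, v⟩ := w
  obtain ⟨-, h1, h2, h3⟩ := h
  simp only at *
  have hk : (k₁ : ℝ) = -(1 + s) * ν - r * s := by exact_mod_cast hF.k₁_eq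
  have hb_sq := hF.b_sq
  have hrs : (r : ℝ) - s ≠ 0 := sub_ne_zero.mpr (by exact_mod_cast hF.r_ne_s)
  -- the eigenvalues at `E_1`, `E_2` have the same modulus, so their half sum is orthogonal to `i y`
  have hcross : (r / 2 * x₂ - (r + 1) * v) * y₁ - (1 + r / 2 * x₁ - (r + 1) * z) * y₂ = 0 := by
    apply mul_left_cancel₀ (mul_pos two_pos hb).ne'
    linear_combination h1 - h2
  have hp : (1 + r / 2 * x₁ - (r + 1) * z) * x₁ + (r / 2 * x₂ - (r + 1) * v) * x₂ = 0 := by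
    rcases hy with hy | hy
    · apply mul_left_cancel₀ hy
      linear_combination x₂ * hcross + (1 + r / 2 * x₁ - (r + 1) * z) * horth
    · apply mul_left_cancel₀ hy
      linear_combination -x₁ * hcross + (r / 2 * x₂ - (r + 1) * v) * horth
  have hp' : x₁ = (r + 1) * (z * x₁ + v * x₂) - r / 2 * (x₁ ^ 2 + x₂ ^ 2) := by
    linear_combination hp
  -- the eigenvalues of `W Wᴴ - n I` at `E_1 + E_2` and at `E_3`, in terms of its coefficients
  set M : ℝ := (x₁ ^ 2 + x₂ ^ 2) * (k₁ + r * s - 2 * r + s) / 4 + r + (k₂ + (1 + r) * (1 + s)) -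
    (z * x₁ + v * x₂) * (1 + r) * s with hM
  set A : ℝ := -((x₁ ^ 2 + x₂ ^ 2) * ν * s) / 4 - ν + (k₂ - 1 + r * s) + 2 * z -
    (z * x₁ + v * x₂) * r * s with hA
  have e1 : r * M - (r + 1) * A = 0 := by
    rw [hM, hA]
    linear_combination (h1 + h2) / 2 - b ^ 2 / 4 * hsum - (r + 1) ^ 2 * hw - r * hp' -
      (4 - (x₁ ^ 2 + x₂ ^ 2)) / 4 * hb_sq + (r + 1) / 4 * (x₁ ^ 2 + x₂ ^ 2) * hk
  have e3 : s * M - (s + 1) * A = 0 := by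
    rw [hM, hA]
    linear_combination h3 - (s + 1) ^ 2 * hw - s * hp' + s / 4 * (x₁ ^ 2 + x₂ ^ 2) * hk + hk
  have hM0 : M = 0 := by
    apply mul_left_cancel₀ hrs
    linear_combination (s + 1) * e1 - (r + 1) * e3
  have hA0 : A = 0 := by
    apply mul_left_cancel₀ hrs
    linear_combination s * e1 - r * e3
  exact ⟨hp', hM0, hA0⟩

/-! ### The possible eigenvalues `r` and `s` -/

namespace AssociationScheme.IsFeasible

variable {k₁ k₂ r s ν : ℤ} {b X p q z : ℝ}

/-- This uses that `p_{11}^2` is an integer and that `ν` is even. -/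
lemma even_s (hF : IsFeasible k₁ k₂ r s ν b) : Even s := by
  obtain ⟨c, hc⟩ := hF.even_ν
  obtain ⟨β, hβ⟩ := hF.four_dvd
  have h := hF.k₁_eq
  have : s = 2 * (2 * β + (1 + s) * c + r) := by
    rw [hc] at h
    linear_combination hβ - h
  rw [this]
  exact even_two_mul _

lemma ν_mul_inter_331 (hF : IsFeasible k₁ k₂ r s ν b) :
    ν * (k₂ + (r + 1) * (s + 1)) = -(r * (r + 1) * s) := by
  linear_combination hF.ν_mul_k₂ + (r + 1) * hF.k₁_eq

/-- A disjoint union of complete graphs has no Hadamard fission. -/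
lemma r_ne_neg_one (hF : IsFeasible k₁ k₂ r s ν b) (hG : GramEquations k₁ k₂ r s ν X p q z)
    (hX : 0 ≤ X) : r ≠ -1 := by
  rintro rfl
  have hν : ν = 0 := by
    have := hF.ν_mul_k₂
    simpa [hF.k₂_pos.ne'] using this
  have hs : k₁ = s := by rw [hF.k₁_eq, hν]; ring
  have h := hG.coeff_one
  have h1 := hF.k₁_pos
  have h2 : 0 ≤ k₂ - 1 + -1 * s := hF.inter_333_nonneg
  have h3 : (1 : ℝ) < k₂ := by
    have : 1 < k₂ := by omega
    exact_mod_cast this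
  have hks : (k₁ : ℝ) = s := by exact_mod_cast hs
  rw [hks] at h
  push_cast at h
  have h4 : (0 : ℝ) ≤ s := by exact_mod_cast (hs ▸ h1.le)
  have : 0 ≤ X * (2 + s) := by positivity
  linarith

/-- If `r ≥ 1`, then the quadratic inequality for `|x|` has negative discriminant. -/
lemma r_lt_one (hF : IsFeasible k₁ k₂ r s ν b) (hG : GramEquations k₁ k₂ r s ν X p q z)
    (hX : 0 ≤ X) (hp : p ^ 2 ≤ X) : r < 1 := by
  by_contra! hr
  have hs : s ≤ -2 := by
    by_contra! hs
    have := hF.inter_131_nonneg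
    nlinarith
  have hν : 0 < ν := by
    have h : 0 < ν * k₂ := by
      rw [hF.ν_mul_k₂]
      exact mul_pos hF.k₁_pos (by omega)
    exact pos_of_mul_pos_left h hF.k₂_pos.le
  set l := k₂ + (r + 1) * (s + 1) with hl
  have hl0 : 0 ≤ l := hF.inter_331_nonneg
  have hlν : ν * l = -(r * (r + 1) * s) := hF.ν_mul_inter_331
  obtain ⟨σ, rfl⟩ : ∃ σ, s = -σ := ⟨-s, by ring⟩
  have hdisc : (r + l) * (k₁ + r * (-σ) - 2 * r + -σ + 2 * r * σ) ≤ σ ^ 2 := by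
    have h1 := hG.coeff_one
    have h2 := hG.p_eq
    have hτ := Real.sq_sqrt hX
    have hpτ : -√X ≤ p := by
      have := Real.sqrt_nonneg X
      exact (abs_le.mp (Real.abs_le_sqrt hp)).1
    set τ := √X
    rw [← hτ] at h1 h2
    have hσ : (0 : ℝ) ≤ σ := by exact_mod_cast (by omega : 0 ≤ σ)
    have hlR : (l : ℝ) = k₂ + (r + 1) * (-σ + 1) := by rw [hl]; push_cast; ring
    push_cast at h1
    -- `|Re x| ≤ |x|` bounds the term with `q` in the coefficient of `A_1 + A_2`
    have hquad : (k₁ + r * (-σ) - 2 * r + -σ + 2 * r * σ : ℝ) * τ ^ 2 - 4 * σ * τ +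
        4 * (r + l) ≤ 0 := by
      have := mul_le_mul_of_nonneg_left hpτ hσ
      rw [h2] at this
      rw [hlR]
      linarith
    have hA : (0 : ℝ) ≤ k₁ + r * (-σ) - 2 * r + -σ + 2 * r * σ := by
      have h4 := hF.inter_112_nonneg
      have : 0 ≤ k₁ + r * (-σ) - 2 * r + -σ + 2 * r * σ := by nlinarith
      exact_mod_cast this
    have hfin : ((r : ℝ) + l) * (k₁ + r * (-σ) - 2 * r + -σ + 2 * r * σ) ≤ σ ^ 2 := by
      have h5 := mul_nonpos_of_nonneg_of_nonpos hA hquad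
      nlinarith [sq_nonneg ((k₁ + r * (-σ) - 2 * r + -σ + 2 * r * σ : ℝ) * τ - 2 * σ)]
    exact_mod_cast hfin
  have hk := hF.k₁_eq
  rw [hk] at hdisc
  have e1 : 0 ≤ (r + l) * ((2 * r - 1) * σ - 2 * r) :=
    mul_nonneg (by omega) (by nlinarith)
  have e2 : σ - 1 ≤ r * ν * (σ - 1) := by
    have : 1 ≤ r * ν := by nlinarith
    nlinarith
  have e3 : 2 * (σ * (σ - 1)) ≤ r * (r + 1) * (σ * (σ - 1)) :=
    mul_le_mul_of_nonneg_right (by nlinarith) (by nlinarith)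
  have e4 : (r + l) * (-(1 + -σ) * ν - r * -σ + r * -σ - 2 * r + -σ + 2 * r * σ) =
      (r + l) * ((2 * r - 1) * σ - 2 * r) + r * ν * (σ - 1) + r * (r + 1) * (σ * (σ - 1)) := by
    linear_combination (σ - 1) * hlν
  nlinarith

/-- If `r ≤ -2`, only the parameters of the Clebsch graph are possible. -/
lemma eq_clebsch_of_r_lt (hF : IsFeasible k₁ k₂ r s ν b)
    (hG : GramEquations k₁ k₂ r s ν X p q z) (hX : 0 ≤ X) (hp : p ^ 2 ≤ X) (hz : -1 ≤ z)
    (hr : r < -1) (hb : 0 < b) : k₁ = 10 ∧ k₂ = 5 ∧ r = -2 ∧ s = 2 ∧ b = 4 := by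
  have hs : 0 ≤ s := by
    by_contra! hs
    have := hF.inter_132_nonneg
    nlinarith
  have hν : ν < 0 := by
    by_contra! hν
    have h1 : 0 ≤ ν * k₂ := mul_nonneg hν hF.k₂_pos.le
    rw [hF.ν_mul_k₂] at h1
    have := hF.k₁_pos
    nlinarith
  set l := k₂ + (r + 1) * (s + 1) with hl
  have hl0 : 0 ≤ l := hF.inter_331_nonneg
  have hlν : ν * l = -(r * (r + 1) * s) := hF.ν_mul_inter_331
  have ht : 0 ≤ k₂ - 1 + r * s := hF.inter_333_nonneg
  obtain ⟨ρ, rfl⟩ : ∃ ρ, r = -ρ := ⟨-r, by ring⟩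
  obtain ⟨ξ, rfl⟩ : ∃ ξ, ν = -ξ := ⟨-ν, by ring⟩
  have hk₂ : k₂ = l + (ρ - 1) * (s + 1) := by rw [hl]; ring
  -- both inequalities come from `ρ |x| - (ρ |x|)² / 2 ≤ 1 / 2`
  have hmain : 2 * (ρ - 1) * (ξ + (ρ - 2 - s + l) - 2) ≤ s ∧ 2 * ρ * (l - ρ) ≤ s := by
    have h1 := hG.coeff_one
    have h2 := hG.p_eq
    have h3 := hG.coeff_three
    have hτ := Real.sq_sqrt hX
    have hτ0 := Real.sqrt_nonneg X
    have hpτ : p ≤ √X := (abs_le.mp (Real.abs_le_sqrt hp)).2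
    set τ := √X
    rw [← hτ] at h1 h2 h3
    have hsR : (0 : ℝ) ≤ s := by exact_mod_cast hs
    have hξR : (0 : ℝ) ≤ ξ := by exact_mod_cast (by omega : 0 ≤ ξ)
    have hρR : (2 : ℝ) ≤ ρ := by exact_mod_cast (by omega : 2 ≤ ρ)
    have hβ : (0 : ℝ) ≤ k₁ + -ρ * s - 2 * -ρ + s := by exact_mod_cast hF.inter_112_nonneg
    have hkR : (k₂ : ℝ) = l + (ρ - 1) * (s + 1) := by exact_mod_cast hk₂
    rw [hkR] at h1 h3
    push_cast at h1 h2 h3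
    have hq : -((ρ - 1) * q) ≤ τ - ρ / 2 * τ ^ 2 := by linarith
    have hsq : 2 * ρ * (τ - ρ / 2 * τ ^ 2) ≤ 1 := by nlinarith [sq_nonneg (ρ * τ - 1)]
    have hqs : -(2 * ρ * s * (ρ - 1) * q) ≤ s := by
      have := mul_le_mul_of_nonneg_left hq (by positivity : 0 ≤ 2 * ρ * (s : ℝ))
      nlinarith
    constructor
    · have : 2 * (ρ - 1) * (ξ + (ρ - 2 - s + l) - 2) ≤ (s : ℝ) := by
        have h4 : ξ + (ρ - 2 - s + l) - 2 ≤ -(q * ρ * s) := by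
          have : 0 ≤ τ ^ 2 * ξ * s := by positivity
          linarith
        have := mul_le_mul_of_nonneg_left h4 (by linarith : 0 ≤ 2 * ((ρ : ℝ) - 1))
        linarith
      exact_mod_cast this
    · have : 2 * ρ * (l - ρ) ≤ (s : ℝ) := by
        have h4 : l - ρ ≤ -(s * (ρ - 1) * q) := by
          have := mul_nonneg (sq_nonneg τ) hβ
          linarith
        have := mul_le_mul_of_nonneg_left h4 (by linarith : 0 ≤ 2 * (ρ : ℝ))
        linarith
      exact_mod_cast this
  obtain ⟨hm1, hm2⟩ := hmain
  have ht' : 0 ≤ ρ - 2 - s + l := by rw [hk₂] at ht; linarith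
  have hlρ : l ≤ ρ := by
    by_contra! h
    nlinarith
  obtain ⟨ξ', hξ'⟩ := hF.even_ν
  have hξ : ξ = 2 := by
    have : ξ + (ρ - 2 - s + l) - 2 ≤ 1 := by
      by_contra! h
      nlinarith
    omega
  subst hξ
  have hsρ : (ρ - 1) * s ≤ 2 := by
    by_contra! h
    nlinarith
  have hs2 : s = 0 ∨ s = 2 := by
    obtain ⟨c, hc⟩ := hF.even_s
    have : s ≤ 2 := by nlinarith
    omega
  have h4 := hF.four_dvd
  have hk₁ := hF.k₁_eq
  rcases hs2 with rfl | rfl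
  · exfalso
    have hl00 : l = 0 := by linarith
    have hρ : ρ = 2 := by
      rw [hl00] at hm1
      nlinarith
    subst hρ
    omega
  · have hρ : ρ = 2 := by omega
    subst hρ
    have hk₁' : k₁ = 10 := by linarith
    have hl2 : l = 2 := by linarith
    have hk₂' : k₂ = 5 := by linarith
    have hb_sq := hF.b_sq
    rw [hk₁'] at hb_sq
    push_cast at hb_sq
    refine ⟨hk₁', hk₂', rfl, rfl, ?_⟩
    nlinarith

end AssociationScheme.IsFeasible

/-! ### The complete multipartite case `r = 0` -/

namespace AssociationScheme

/-- If `r = 0`, then `A_1 + A_2` is a complete multipartite graph with parts of size `2 a`. The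
multiplicity of `s` is `(2 a - 1) c`; as `E_1` and `E_2` have the same rank, it is odd. -/
theorem exists_multipartite_parameters {X : Type*} [Fintype X] [DecidableEq X]
    {S : AssociationScheme X 3} {k₁ k₂ : ℕ} {s ν : ℤ} {b : ℝ} (hb : 0 < b)
    (hP : S.IsFirstEigenmatrix (nonsymmEigenmatrix k₁ k₂ 0 s b))
    (hF : IsFeasible k₁ k₂ 0 s ν b) :
    ∃ a c : ℕ, 0 < a ∧ Odd c ∧ (k₁ : ℤ) = 2 * a * (2 * a - 1) * c ∧ (k₂ : ℤ) = 2 * a - 1 ∧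
      s = -2 * a ∧ b = 2 * a * √c ∧ ν = 2 * a * c := by
  obtain ⟨t, ht⟩ := hF.even_s
  have hs := hF.inter_131_nonneg
  obtain ⟨a, ha⟩ : ∃ a : ℕ, s = -2 * a := ⟨(-t).toNat, by omega⟩
  have ha0 : 0 < a := by omega
  have hk₁ := hF.k₁_eq
  have hνk : ν * k₂ = k₁ := by linarith [hF.ν_mul_k₂]
  have hν : 0 < ν := by
    have h := hF.k₁_pos
    rw [← hνk] at h
    exact pos_of_mul_pos_left h hF.k₂_pos.le
  have hk₂ : (k₂ : ℤ) = 2 * a - 1 := by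
    have h : ν * (k₂ + (0 + 1) * (s + 1)) = 0 := by rw [hF.ν_mul_inter_331]; ring
    have := (mul_eq_zero.mp h).resolve_left hν.ne'
    linarith
  -- the multiplicities of `E_1`, `E_2`, `E_3`
  obtain ⟨m, hm0, hm⟩ := hP.exists_multiplicities
  have e1 := congrArg Complex.re (hm 1)
  have e1' := congrArg Complex.im (hm 1)
  have e3 := congrArg Complex.re (hm 3)
  simp [nonsymmEigenmatrix, Fin.sum_univ_four, hm0] at e1 e1' e3
  have h12 : (m 1 : ℝ) = m 2 := by
    apply mul_left_cancel₀ (half_pos hb).ne'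
    linarith
  have h12' : m 1 = m 2 := by exact_mod_cast h12
  have e1Z : (k₁ : ℤ) = -s * m 3 := by
    have : (k₁ : ℝ) = -s * m 3 := by linarith
    exact_mod_cast this
  have e3Z : (k₂ : ℤ) - m 1 - m 2 - (s + 1) * m 3 = 0 := by
    have : (k₂ : ℝ) - m 1 - m 2 - (s + 1) * m 3 = 0 := by linarith
    exact_mod_cast this
  have hνa : ν = 2 * a * (ν - m 3) := by
    have : ν * (2 * a - 1) = 2 * a * m 3 := by rw [← hk₂, hνk, e1Z, ha]; ring
    linarith
  have hc0 : 0 < ν - m 3 := by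
    rw [hνa] at hν
    exact pos_of_mul_pos_right hν (by positivity)
  obtain ⟨c, hc⟩ := Int.eq_ofNat_of_zero_le hc0.le
  rw [hc] at hνa
  have hm3 : (m 3 : ℤ) = (2 * a - 1) * c := by linarith
  have hodd : Odd c := by
    have h1 : (2 * (m 1 : ℤ)) = (2 * a - 1) * ((2 * a - 1) * c + 1) := by
      rw [← hm3]
      rw [h12', ha] at *
      linarith
    have h2 : Even (((2 * a - 1 : ℤ)) * ((2 * a - 1) * c + 1)) := h1 ▸ even_two_mul _
    have h3 : ¬ Even (2 * a - 1 : ℤ) := by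
      rw [Int.not_even_iff_odd]
      exact ⟨a - 1, by ring⟩
    rw [Int.even_mul, or_iff_right h3, Int.even_add_one, Int.even_mul, or_iff_right h3] at h2
    rwa [← Nat.not_even_iff_odd, ← Int.even_coe_nat]
  have hb_sq : b ^ 2 = (2 * a * √c) ^ 2 := by
    rw [mul_pow, Real.sq_sqrt (Nat.cast_nonneg c), hF.b_sq, ← hνk, hk₂, hνa]
    push_cast
    ring
  refine ⟨a, c, ha0, hodd, ?_, hk₂, ha, ?_, hνa⟩
  · rw [← hνk, hνa, hk₂]; ring
  · exact (pow_left_inj₀ hb.le (by positivity) two_ne_zero).mp hb_sq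

end AssociationScheme

/-- If `a ≥ 1` and `c` is odd, then the bound `|Re x| ≤ |x|` only leaves `c = 1` and
`(a, c) = (1, 3)`. -/
lemma multipartite_bound {a c : ℕ} (ha : 0 < a) (hc : Odd c) {x₁ x₂ z : ℝ} (hz : z ≤ 1)
    (h₁ : (x₁ ^ 2 + x₂ ^ 2) * ((2 * a - 1) * c - 1) = -4 * x₁)
    (h₃ : a ^ 2 * c * (x₁ ^ 2 + x₂ ^ 2) = 2 - 2 * z + 2 * a * (c - 1)) :
    c = 1 ∨ a = 1 ∧ c = 3 := by
  by_cases hc1 : c = 1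
  · exact Or.inl hc1
  right
  have hc3 : 3 ≤ c := by obtain ⟨d, hd⟩ := hc; omega
  have hcR : (3 : ℝ) ≤ c := by exact_mod_cast hc3
  have haR : (1 : ℝ) ≤ a := by exact_mod_cast ha
  set X := x₁ ^ 2 + x₂ ^ 2 with hX
  set K : ℝ := (2 * a - 1) * c - 1 with hK
  have hXlow : 2 * a * ((c : ℝ) - 1) ≤ a ^ 2 * c * X := by linarith
  have hXpos : 0 < X := by
    by_contra! h
    have h1 : (a : ℝ) ^ 2 * c * X ≤ 0 := mul_nonpos_of_nonneg_of_nonpos (by positivity) h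
    have h2 : 0 < 2 * a * ((c : ℝ) - 1) := mul_pos (by positivity) (by linarith)
    linarith
  have hXK : X * K ^ 2 ≤ 16 := by
    have h1 : X * (X * K ^ 2) = 16 * x₁ ^ 2 := by
      rw [show X * (X * K ^ 2) = (X * K) ^ 2 by ring, h₁]; ring
    have h2 : X * (X * K ^ 2) ≤ X * 16 := by rw [h1, hX]; nlinarith [sq_nonneg x₂]
    exact le_of_mul_le_mul_left h2 hXpos
  have hbound : ((c : ℝ) - 1) * K ^ 2 ≤ 8 * a * c := by
    have h1 := mul_le_mul_of_nonneg_right hXlow (sq_nonneg K)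
    have h2 := mul_le_mul_of_nonneg_left hXK (by positivity : 0 ≤ (a : ℝ) ^ 2 * c)
    have h3 : 2 * (a : ℝ) * (((c : ℝ) - 1) * K ^ 2) ≤ 2 * a * (8 * a * c) := by nlinarith
    exact le_of_mul_le_mul_left h3 (by positivity)
  have ha1 : a = 1 := by
    by_contra hne
    have ha2 : (2 : ℝ) ≤ a := by exact_mod_cast (by omega : 2 ≤ a)
    have hKac : a * c ≤ K := by rw [hK]; nlinarith
    have h1 : (a * c : ℝ) ^ 2 ≤ K ^ 2 := pow_le_pow_left₀ (by positivity) hKac 2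
    have h2 : 2 * (a * c : ℝ) ^ 2 ≤ (c - 1) * K ^ 2 := by nlinarith [sq_nonneg K]
    have h3 : (6 : ℝ) ≤ a * c := by nlinarith
    nlinarith
  refine ⟨ha1, ?_⟩
  by_contra hne
  have hc5 : (5 : ℝ) ≤ c := by
    have : 5 ≤ c := by obtain ⟨d, hd⟩ := hc; omega
    exact_mod_cast this
  have hK1 : K = c - 1 := by rw [hK, ha1]; push_cast; ring
  rw [hK1, ha1] at hbound
  push_cast at hbound
  nlinarith [mul_nonneg (by linarith : 0 ≤ (c : ℝ) - 1) (by nlinarith : 0 ≤ ((c : ℝ) - 1) ^ 2 - 16)]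

/-- For `w ≠ 1`, the Gram determinant of `1`, `w = z + v i` and `x` gives a second relation between
`x` and `z`. -/
lemma gram_of_ne_one {x₁ x₂ z v : ℝ} (hw : z ^ 2 + v ^ 2 = 1) (hz : z ≠ 1)
    (hp : x₁ = z * x₁ + v * x₂) : 2 * x₁ ^ 2 = (1 + z) * (x₁ ^ 2 + x₂ ^ 2) := by
  apply mul_left_cancel₀ (sub_ne_zero.mpr hz.symm)
  linear_combination ((1 - z) * x₁ + v * x₂) * hp + x₂ ^ 2 * hw

lemma eq_zero_of_re_eq_one {z v : ℝ} (hw : z ^ 2 + v ^ 2 = 1) (hz : z = 1) : v = 0 := by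
  subst hz
  have : v ^ 2 = 0 := by linarith
  simpa using this

/-- For `c = 1` the equations determine `w₃ = z + v i` and `x = x₁ + x₂ i` up to conjugation, unless
`w₃ = 1`. The bound `|x| < 2`, from `w₁ ≠ w₂`, excludes the second solution for `a = 1`. -/
lemma solve_multipartite_one {a : ℕ} (ha : 0 < a) {x₁ x₂ z v : ℝ} (hw : z ^ 2 + v ^ 2 = 1)
    (hX : x₁ ^ 2 + x₂ ^ 2 < 4) (hp : x₁ = z * x₁ + v * x₂)
    (h₁ : (x₁ ^ 2 + x₂ ^ 2) * (2 * a - 2) = -4 * x₁)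
    (h₃ : a ^ 2 * (x₁ ^ 2 + x₂ ^ 2) = 2 - 2 * z) :
    (z = 1 ∧ v = 0 ∧ x₁ = 0 ∧ x₂ = 0) ∨ ∃ ε : ℝ, (ε = 1 ∨ ε = -1) ∧
      z = (1 - 2 * a) / (2 * a ^ 2 - 2 * a + 1) ∧
      v = ε * (2 * a * (a - 1) / (2 * a ^ 2 - 2 * a + 1)) ∧
      x₁ = -2 * (a - 1) / (2 * a ^ 2 - 2 * a + 1) ∧
      x₂ = ε * (-2 * a / (2 * a ^ 2 - 2 * a + 1)) := by
  have haR : (1 : ℝ) ≤ a := by exact_mod_cast ha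
  by_cases hz : z = 1
  · left
    have hX0 : x₁ ^ 2 + x₂ ^ 2 = 0 := by
      rw [hz] at h₃
      have : (a : ℝ) ^ 2 * (x₁ ^ 2 + x₂ ^ 2) = 0 := by linarith
      exact (mul_eq_zero.mp this).resolve_left (by positivity)
    refine ⟨hz, eq_zero_of_re_eq_one hw hz, ?_, ?_⟩ <;> nlinarith [sq_nonneg x₁, sq_nonneg x₂]
  right
  have hg := gram_of_ne_one hw hz hp
  have hD : (0 : ℝ) < 2 * a ^ 2 - 2 * a + 1 := by nlinarith
  generalize hDa : 2 * (a : ℝ) ^ 2 - 2 * a + 1 = D at *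
  have hX0 : x₁ ^ 2 + x₂ ^ 2 ≠ 0 := by
    intro h
    rw [h] at h₃
    exact hz (by linarith)
  have hx₁ : x₁ = -((a : ℝ) - 1) / 2 * (x₁ ^ 2 + x₂ ^ 2) := by linarith
  have hz1 : ((a : ℝ) - 1) ^ 2 * (x₁ ^ 2 + x₂ ^ 2) = 2 * (1 + z) := by
    apply mul_left_cancel₀ hX0
    have : 2 * (-((a : ℝ) - 1) / 2 * (x₁ ^ 2 + x₂ ^ 2)) ^ 2 = (1 + z) * (x₁ ^ 2 + x₂ ^ 2) := by
      rw [← hx₁]; exact hg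
    linear_combination 2 * this
  have hXD : x₁ ^ 2 + x₂ ^ 2 = 4 / D := by
    rw [eq_div_iff hD.ne']
    linear_combination h₃ + hz1 - (x₁ ^ 2 + x₂ ^ 2) * hDa
  have hz' : z = (1 - 2 * a) / D := by
    rw [hXD, ← mul_div_assoc, div_eq_iff hD.ne'] at h₃
    rw [eq_div_iff hD.ne']
    linear_combination h₃ / 2 - hDa
  have hx₁' : x₁ = -2 * (a - 1) / D := by
    rw [hx₁, hXD]
    field_simp
    ring
  have ha1 : (1 : ℝ) < a := by
    rcases haR.lt_or_eq with h | h
    · exact h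
    · rw [← h] at hDa
      rw [← hDa] at hXD
      norm_num at hXD
      linarith
  have hv : v = 2 * a * (a - 1) / D ∨
      v = -(2 * a * (a - 1) / D) := by
    rw [← sq_eq_sq_iff_eq_or_eq_neg]
    have : v ^ 2 = 1 - z ^ 2 := by linarith
    rw [this, hz']
    field_simp
    rw [← hDa]
    ring
  have hx₂ : v * x₂ = (1 - z) * x₁ := by linarith
  have hv0 : 2 * a * (a - 1) / D ≠ 0 :=
    (div_pos (mul_pos (by linarith) (by linarith)) hD).ne'
  have hx : (1 - z) * x₁ = 2 * a * (a - 1) / D *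
      (-2 * a / D) := by
    rw [hz', hx₁']
    field_simp
    rw [← hDa]
    ring
  rw [hx] at hx₂
  rcases hv with hv | hv
  · refine ⟨1, Or.inl rfl, hz', by rw [hv, one_mul], hx₁', ?_⟩
    rw [hv] at hx₂
    rw [one_mul]
    exact mul_left_cancel₀ hv0 hx₂
  · refine ⟨-1, Or.inr rfl, hz', by rw [hv]; ring, hx₁', ?_⟩
    rw [hv] at hx₂
    apply mul_left_cancel₀ hv0
    linarith

/-- The equations for `w₃ = z + v i` and `x = x₁ + x₂ i` when `(a, c) = (1, 3)`. -/
lemma solve_multipartite_three {x₁ x₂ z v : ℝ} (hw : z ^ 2 + v ^ 2 = 1)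
    (hp : x₁ = z * x₁ + v * x₂) (h₁ : (x₁ ^ 2 + x₂ ^ 2) * 2 = -4 * x₁)
    (h₃ : 3 * (x₁ ^ 2 + x₂ ^ 2) = 6 - 2 * z) :
    ∃ ε : ℝ, (ε = 1 ∨ ε = -1) ∧
      ((z = 1 ∧ v = 0 ∧ x₁ = -2 / 3 ∧ x₂ = ε * (2 * √2 / 3)) ∨
        (z = 0 ∧ v = ε ∧ x₁ = -1 ∧ x₂ = -ε)) := by
  by_cases hz : z = 1
  · have hv := eq_zero_of_re_eq_one hw hz
    have hx₁ : x₁ = -2 / 3 := by rw [hz] at h₃; linarith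
    have hx₂ : x₂ = 2 * √2 / 3 ∨ x₂ = -(2 * √2 / 3) := by
      rw [← sq_eq_sq_iff_eq_or_eq_neg]
      have h2 := Real.sq_sqrt (show (0 : ℝ) ≤ 2 by norm_num)
      rw [hx₁] at h₁
      linear_combination h₁ / 2 - 4 / 9 * h2
    rcases hx₂ with hx₂ | hx₂
    · exact ⟨1, Or.inl rfl, Or.inl ⟨hz, hv, hx₁, by rw [hx₂, one_mul]⟩⟩
    · exact ⟨-1, Or.inr rfl, Or.inl ⟨hz, hv, hx₁, by rw [hx₂]; ring⟩⟩
  · have hg := gram_of_ne_one hw hz hp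
    have hX : x₁ ^ 2 + x₂ ^ 2 = -2 * x₁ := by linarith
    rw [hX] at hg h₃
    have hx0 : x₁ ≠ 0 := by
      intro h
      rw [h] at h₃
      nlinarith
    have hx₁ : x₁ = -(1 + z) := by
      apply mul_left_cancel₀ hx0
      linarith
    have hz0 : z = 0 := by linarith
    have hx₁' : x₁ = -1 := by linarith
    rw [hz0] at hw hp
    rw [hx₁'] at hp
    have hv : v = 1 ∨ v = -1 := by
      rw [← sq_eq_sq_iff_eq_or_eq_neg]; linarith
    rcases hv with hv | hv
    · exact ⟨1, Or.inl rfl, Or.inr ⟨hz0, hv, hx₁', by rw [hv] at hp; linarith⟩⟩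
    · exact ⟨-1, Or.inr rfl, Or.inr ⟨hz0, hv, hx₁', by rw [hv] at hp; linarith⟩⟩

/-- Two points of the unit circle are determined by their sum, if it is nonzero. -/
lemma eq_or_swap_of_add_eq_add {w₁ w₂ u₁ u₂ : ℂ} (hw₁ : ‖w₁‖ = 1) (hw₂ : ‖w₂‖ = 1)
    (hu₁ : ‖u₁‖ = 1) (hu₂ : ‖u₂‖ = 1) (h : w₁ + w₂ = u₁ + u₂) (h0 : u₁ + u₂ ≠ 0) :
    (w₁ = u₁ ∧ w₂ = u₂) ∨ (w₁ = u₂ ∧ w₂ = u₁) := by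
  have hmul : ∀ {v : ℂ}, ‖v‖ = 1 → v * star v = 1 := by
    intro v hv
    rw [Complex.star_def, Complex.mul_conj, Complex.normSq_eq_norm_sq, hv]; simp
  have hstar : star w₁ + star w₂ = star u₁ + star u₂ := by
    rw [← star_add, h, star_add]
  have h0' : star u₁ + star u₂ ≠ 0 := by
    rw [← star_add]; exact star_ne_zero.mpr h0
  have hprod : w₁ * w₂ = u₁ * u₂ := by
    apply mul_right_cancel₀ h0'
    linear_combination -w₁ * w₂ * hstar + w₂ * hmul hw₁ + w₁ * hmul hw₂ - u₂ * hmul hu₁ -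
      u₁ * hmul hu₂ + h
  have : (w₁ - u₁) * (w₁ - u₂) = 0 := by
    linear_combination w₁ * h - hprod
  rcases mul_eq_zero.mp this with h1 | h1
  · have h1 := sub_eq_zero.mp h1
    exact Or.inl ⟨h1, by linear_combination h - h1⟩
  · have h1 := sub_eq_zero.mp h1
    exact Or.inr ⟨h1, by linear_combination h - h1⟩

/-! ### The explicit triples -/

section wSign

variable {a : ℕ} {ε : ℝ}

lemma wSign_eq (a : ℕ) (ε : ℝ) :
    wSign a ε = ⟨(-(a - 1) - ε * (a * √(2 * a * (a - 1)))) / (2 * a ^ 2 - 2 * a + 1),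
      (-a + ε * ((a - 1) * √(2 * a * (a - 1)))) / (2 * a ^ 2 - 2 * a + 1)⟩ := by
  have h : (2 * (a : ℂ) ^ 2 - 2 * a + 1) = ((2 * a ^ 2 - 2 * a + 1 : ℝ) : ℂ) := by push_cast; rfl
  rw [wSign, h]
  apply Complex.ext
  · rw [Complex.div_ofReal_re]; simp
  · rw [Complex.div_ofReal_im]; simp

lemma two_mul_sq_sub_pos (ha : 0 < a) : (0 : ℝ) < 2 * a ^ 2 - 2 * a + 1 := by
  nlinarith [sq_nonneg ((a : ℝ) - 1), (by exact_mod_cast ha : (0 : ℝ) < a)]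

lemma sq_sqrt_radicand (ha : 0 < a) : √(2 * a * (a - 1) : ℝ) ^ 2 = 2 * a * (a - 1) := by
  have haR : (1 : ℝ) ≤ a := by exact_mod_cast ha
  exact Real.sq_sqrt (mul_nonneg (by positivity) (by linarith))

lemma wSign_add_wSign_neg (a : ℕ) (ε : ℝ) : wSign a ε + wSign a (-ε) =
    ⟨-2 * (a - 1) / (2 * a ^ 2 - 2 * a + 1), -2 * a / (2 * a ^ 2 - 2 * a + 1)⟩ := by
  rw [wSign_eq, wSign_eq]
  apply Complex.ext <;> simp <;> ring

lemma wSign_sub_wSign_neg (a : ℕ) (ε : ℝ) : wSign a ε - wSign a (-ε) =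
    ⟨ε * √(2 * a * (a - 1)) * (-2 * a / (2 * a ^ 2 - 2 * a + 1)),
      ε * √(2 * a * (a - 1)) * (2 * (a - 1) / (2 * a ^ 2 - 2 * a + 1))⟩ := by
  rw [wSign_eq, wSign_eq]
  apply Complex.ext <;> simp <;> ring

lemma wSign_mul_wSign_neg (ha : 0 < a) (hε : ε = 1 ∨ ε = -1) : wSign a ε * wSign a (-ε) =
    ⟨(1 - 2 * a) / (2 * a ^ 2 - 2 * a + 1), 2 * a * (a - 1) / (2 * a ^ 2 - 2 * a + 1)⟩ := by
  have hD := two_mul_sq_sub_pos ha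
  have hR := sq_sqrt_radicand ha
  have hε2 : ε ^ 2 = 1 := by rcases hε with rfl | rfl <;> norm_num
  rw [wSign_eq, wSign_eq]
  generalize √(2 * a * (a - 1) : ℝ) = R at *
  generalize hDa : 2 * (a : ℝ) ^ 2 - 2 * a + 1 = D at *
  have hRD : R ^ 2 * ε ^ 2 = D - 1 := by rw [hε2, hR, ← hDa]; ring
  apply Complex.ext
  · simp only [Complex.mul_re]
    field_simp
    rw [← hDa] at hRD ⊢
    linear_combination (1 - 2 * (a : ℝ)) * hRD
  · simp only [Complex.mul_im]
    field_simp
    rw [← hDa] at hRD ⊢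
    linear_combination 2 * (a : ℝ) * (a - 1) * hRD

lemma norm_wSign (ha : 0 < a) (hε : ε = 1 ∨ ε = -1) : ‖wSign a ε‖ = 1 := by
  have hD := two_mul_sq_sub_pos ha
  have hR := sq_sqrt_radicand ha
  have hε2 : ε ^ 2 = 1 := by rcases hε with rfl | rfl <;> norm_num
  rw [← pow_eq_one_iff_of_nonneg (norm_nonneg _) two_ne_zero, ← Complex.normSq_eq_norm_sq,
    wSign_eq, Complex.normSq_mk]
  generalize √(2 * a * (a - 1) : ℝ) = R at *
  generalize hDa : 2 * (a : ℝ) ^ 2 - 2 * a + 1 = D at *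
  have hRD : R ^ 2 * ε ^ 2 = D - 1 := by rw [hε2, hR, ← hDa]; ring
  field_simp
  rw [← hDa] at hRD ⊢
  linear_combination (2 * (a : ℝ) ^ 2 - 2 * a + 1) * hRD

end wSign

namespace AssociationScheme

lemma EigenvalueEquations.star {k₁ k₂ r s b : ℝ} {x y w : ℂ}
    (h : EigenvalueEquations k₁ k₂ r s b x y w) :
    EigenvalueEquations k₁ k₂ r s b (Star.star x) (Star.star y) (Star.star w) := by
  obtain ⟨h0, h1, h2, h3⟩ := h
  simp only [EigenvalueEquations, Complex.star_def, Complex.conj_re, Complex.conj_im]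
  refine ⟨?_, ?_, ?_, ?_⟩
  · rw [← h0]; ring
  · rw [← h2]; ring
  · rw [← h1]; ring
  · rw [← h3]; ring

lemma EigenvalueEquations.neg {k₁ k₂ r s b : ℝ} {x y w : ℂ}
    (h : EigenvalueEquations k₁ k₂ r s b x y w) :
    EigenvalueEquations k₁ k₂ r s b x (-y) w := by
  obtain ⟨h0, h1, h2, h3⟩ := h
  refine ⟨h0, ?_, ?_, h3⟩
  · rw [← h2]; simp; ring
  · rw [← h1]; simp; ring

lemma eigenvalueEquations_wSign {a : ℕ} (ha : 0 < a) {ε : ℝ} (hε : ε = 1 ∨ ε = -1) :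
    EigenvalueEquations (2 * a * (2 * a - 1)) (2 * a - 1) 0 (-2 * a) (2 * a)
      (wSign a ε + wSign a (-ε)) (wSign a ε - wSign a (-ε)) (wSign a ε * wSign a (-ε)) := by
  rw [wSign_mul_wSign_neg ha hε, wSign_add_wSign_neg, wSign_sub_wSign_neg]
  have hD := two_mul_sq_sub_pos ha
  have hR := sq_sqrt_radicand ha
  have hε2 : ε ^ 2 = 1 := by rcases hε with rfl | rfl <;> norm_num
  simp only [EigenvalueEquations]
  generalize √(2 * a * (a - 1) : ℝ) = R at *
  generalize hDa : 2 * (a : ℝ) ^ 2 - 2 * a + 1 = D at *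
  have hRD : R ^ 2 * ε ^ 2 = D - 1 := by rw [hε2, hR, ← hDa]; ring
  refine ⟨?_, ?_, ?_, ?_⟩
  · field_simp
    rw [← hDa]
    ring
  · field_simp
    rw [← hDa] at hRD ⊢
    linear_combination 4 * (a : ℝ) ^ 2 * (2 * a ^ 2 - 2 * a + 1) * hRD
  · field_simp
    rw [← hDa] at hRD ⊢
    linear_combination 4 * (a : ℝ) ^ 2 * (2 * a ^ 2 - 2 * a + 1) * hRD
  · field_simp
    rw [← hDa]
    ring

lemma eigenvalueEquations_neg_one {a : ℕ} {w : ℂ} (hw : ‖w‖ = 1) :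
    EigenvalueEquations (2 * a * (2 * a - 1)) (2 * a - 1) 0 (-2 * a) (2 * a) (w + -w) (w - -w)
      1 := by
  have h : w.re ^ 2 + w.im ^ 2 = 1 := by
    rw [sq, sq, ← Complex.normSq_apply, Complex.normSq_eq_norm_sq, hw, one_pow]
  simp only [EigenvalueEquations]
  simp
  refine ⟨by ring, ?_, by ring⟩
  linear_combination 4 * (a : ℝ) ^ 2 * h

lemma eigenvalueEquations_three {ε : ℝ} (hε : ε = 1 ∨ ε = -1) :
    EigenvalueEquations 6 1 0 (-2) (2 * √3) (⟨1 / 3, ε * (2 * √2 / 3)⟩ + -1)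
      (⟨1 / 3, ε * (2 * √2 / 3)⟩ - -1) 1 ∧
    EigenvalueEquations 6 1 0 (-2) (2 * √3) (⟨0, ε⟩ + -1) (⟨0, ε⟩ - -1) (-⟨0, ε⟩) := by
  have h2 := Real.sq_sqrt (show (0 : ℝ) ≤ 2 by norm_num)
  have h3 := Real.sq_sqrt (show (0 : ℝ) ≤ 3 by norm_num)
  have hε2 : ε ^ 2 = 1 := by rcases hε with rfl | rfl <;> norm_num
  generalize √2 = R at *
  generalize √3 = T at *
  simp only [EigenvalueEquations]
  simp
  refine ⟨⟨?_, ?_, ?_⟩, ?_, ?_, ?_, ?_⟩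
  · linear_combination 4 * ε ^ 2 * h2 + 8 * hε2
  · linear_combination (4 / 9 * ε ^ 2 * R ^ 2 + 16 / 9) * h3 + 4 / 3 * ε ^ 2 * h2 + 8 / 3 * hε2
  · linear_combination 4 / 9 * ε ^ 2 * h2 + 8 / 9 * hε2
  · linear_combination 4 * hε2
  · linear_combination (1 + ε ^ 2) * h3 + 4 * hε2
  · linear_combination (1 + ε ^ 2) * h3 + 4 * hε2
  · linear_combination 4 * hε2

end AssociationScheme

/-! ### The classification -/

lemma three_add_four_eq (ε : ℝ) :
    (3 + (ε : ℂ) * 4 * Complex.I) / 5 = ⟨3 / 5, ε * (4 / 5)⟩ := by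
  apply Complex.ext
  · simp
  · simp; ring

lemma one_add_two_sqrt_two_eq (ε : ℝ) :
    (1 + (ε : ℂ) * (2 * (√2 : ℂ)) * Complex.I) / 3 = ⟨1 / 3, ε * (2 * √2 / 3)⟩ := by
  apply Complex.ext
  · simp
  · simp; ring

lemma mul_I_eq (ε : ℝ) : (ε : ℂ) * Complex.I = ⟨0, ε⟩ := by
  apply Complex.ext <;> simp

lemma wSign_two_one : wSign 2 1 = -1 := by
  have h : √(2 * (2 : ℕ) * ((2 : ℕ) - 1) : ℝ) = 2 := by
    rw [Real.sqrt_eq_iff_mul_self_eq] <;> norm_num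
  rw [wSign_eq, h]
  apply Complex.ext <;> norm_num

lemma wSign_two_neg_one : wSign 2 (-1) = (3 + ((-1 : ℝ) : ℂ) * 4 * Complex.I) / 5 := by
  have h : √(2 * (2 : ℕ) * ((2 : ℕ) - 1) : ℝ) = 2 := by
    rw [Real.sqrt_eq_iff_mul_self_eq] <;> norm_num
  rw [wSign_eq, h, three_add_four_eq]
  apply Complex.ext <;> norm_num

namespace AssociationScheme

lemma EigenvalueEquations.swap {k₁ k₂ r s b : ℝ} {w₁ w₂ w : ℂ}
    (h : EigenvalueEquations k₁ k₂ r s b (w₁ + w₂) (w₁ - w₂) w) :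
    EigenvalueEquations k₁ k₂ r s b (w₂ + w₁) (w₂ - w₁) w := by
  rw [add_comm w₂, ← neg_sub w₁]
  exact h.neg

theorem eigenvalueEquations_of_isTripleOne {a : ℕ} (ha : 0 < a) {w₁ w₂ w₃ : ℂ}
    (h : IsTripleOne a w₁ w₂ w₃) :
    EigenvalueEquations (2 * a * (2 * a - 1)) (2 * a - 1) 0 (-2 * a) (2 * a)
      (w₁ + w₂) (w₁ - w₂) w₃ := by
  have hstar : ∀ {ε : ℝ}, ε = 1 ∨ ε = -1 →
      EigenvalueEquations (2 * a * (2 * a - 1)) (2 * a - 1) 0 (-2 * a) (2 * a)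
        (star (wSign a ε) + star (wSign a (-ε))) (star (wSign a ε) - star (wSign a (-ε)))
        (star (wSign a ε * wSign a (-ε))) := by
    intro ε hε
    rw [← star_add, ← star_sub]
    exact (eigenvalueEquations_wSign ha hε).star
  rcases h with ⟨w, hw, h⟩ | ⟨ε, hε, h | h⟩ | ⟨rfl, ε, hε, h⟩
  · simp only [Prod.mk.injEq] at h
    obtain ⟨rfl, rfl, rfl⟩ := h
    exact eigenvalueEquations_neg_one hw
  · simp only [Prod.mk.injEq] at h
    obtain ⟨rfl, rfl, rfl⟩ := h
    exact eigenvalueEquations_wSign ha hε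
  · simp only [Prod.mk.injEq] at h
    obtain ⟨rfl, rfl, rfl⟩ := h
    exact hstar hε
  · -- for `a = 2` the two numbers `w_±` are `-1` and `(3 - 4 i) / 5`
    have h1 := eigenvalueEquations_wSign (a := 2) ha (Or.inl rfl)
    have h2 := hstar (Or.inl rfl)
    rw [wSign_two_one, wSign_two_neg_one] at h1 h2
    have e1 : star ((3 + ((-1 : ℝ) : ℂ) * 4 * Complex.I) / 5) =
        (3 + ((1 : ℝ) : ℂ) * 4 * Complex.I) / 5 := by
      rw [three_add_four_eq, three_add_four_eq]
      apply Complex.ext <;> simp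
    rw [star_mul, star_neg, star_one, e1, mul_neg_one] at h2
    rw [neg_one_mul] at h1
    have h3 : ∀ ε : ℂ, (-3 - ε * 4 * Complex.I) / 5 = -((3 + ε * 4 * Complex.I) / 5) := by
      intro ε; ring
    rw [h3] at h
    simp only [Prod.mk.injEq] at h
    rcases hε with rfl | rfl
    · simp only [Complex.ofReal_one] at h2
      rcases h with ⟨rfl, rfl, rfl⟩ | ⟨rfl, rfl, rfl⟩
      · exact h2.swap
      · exact h2
    · simp only [Complex.ofReal_neg, Complex.ofReal_one] at h1
      rcases h with ⟨rfl, rfl, rfl⟩ | ⟨rfl, rfl, rfl⟩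
      · exact h1.swap
      · exact h1

theorem eigenvalueEquations_of_isTripleThree {w₁ w₂ w₃ : ℂ} (h : IsTripleThree w₁ w₂ w₃) :
    EigenvalueEquations 6 1 0 (-2) (2 * √3) (w₁ + w₂) (w₁ - w₂) w₃ := by
  obtain ⟨ε', hε', h⟩ := h
  obtain ⟨ε, hε, rfl⟩ : ∃ ε : ℝ, (ε = 1 ∨ ε = -1) ∧ ε' = (ε : ℂ) := by
    rcases hε' with rfl | rfl
    · exact ⟨1, by simp⟩
    · exact ⟨-1, by simp⟩
  rw [one_add_two_sqrt_two_eq, mul_I_eq] at h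
  simp only [Prod.mk.injEq] at h
  obtain ⟨h1, h2⟩ := eigenvalueEquations_three hε
  rcases h with ⟨rfl, rfl, rfl⟩ | ⟨rfl, rfl, rfl⟩ | ⟨rfl, rfl, rfl⟩ | ⟨rfl, rfl, rfl⟩
  · exact h1
  · exact h1.swap
  · exact h2
  · exact h2.swap

lemma isTripleOne_of_solution {a : ℕ} (ha : 0 < a) {w₁ w₂ w₃ : ℂ} (hw₁ : ‖w₁‖ = 1)
    (hw₂ : ‖w₂‖ = 1)
    (h : (w₃.re = 1 ∧ w₃.im = 0 ∧ (w₁ + w₂).re = 0 ∧ (w₁ + w₂).im = 0) ∨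
      ∃ ε : ℝ, (ε = 1 ∨ ε = -1) ∧
      w₃.re = (1 - 2 * a) / (2 * a ^ 2 - 2 * a + 1) ∧
      w₃.im = ε * (2 * a * (a - 1) / (2 * a ^ 2 - 2 * a + 1)) ∧
      (w₁ + w₂).re = -2 * (a - 1) / (2 * a ^ 2 - 2 * a + 1) ∧
      (w₁ + w₂).im = ε * (-2 * a / (2 * a ^ 2 - 2 * a + 1))) :
    IsTripleOne a w₁ w₂ w₃ := by
  rcases h with ⟨h1, h2, h3, h4⟩ | ⟨ε, hε, h1, h2, h3, h4⟩
  · left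
    have e3 : w₃ = 1 := Complex.ext h1 h2
    have e0 : w₁ + w₂ = 0 := Complex.ext h3 h4
    exact ⟨w₁, hw₁, by rw [e3, eq_neg_of_add_eq_zero_right e0]⟩
  right; left
  have hD := two_mul_sq_sub_pos ha
  have haR : (0 : ℝ) < a := by exact_mod_cast ha
  have hn1 : ‖wSign a 1‖ = 1 := norm_wSign ha (Or.inl rfl)
  have hn2 : ‖wSign a (-1)‖ = 1 := norm_wSign ha (Or.inr rfl)
  have hne : wSign a 1 + wSign a (-1) ≠ 0 := by
    rw [wSign_add_wSign_neg]
    intro h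
    have := congrArg Complex.im h
    simp [hD.ne', haR.ne'] at this
  have hmul : wSign a (-1) * wSign a 1 = wSign a 1 * wSign a (-1) := mul_comm _ _
  rcases hε with rfl | rfl
  · have hs : w₁ + w₂ = wSign a 1 + wSign a (-1) := by
      rw [wSign_add_wSign_neg]
      exact Complex.ext h3 (by rw [h4, one_mul])
    have h₃ : w₃ = wSign a 1 * wSign a (-1) := by
      rw [wSign_mul_wSign_neg ha (Or.inl rfl)]
      exact Complex.ext h1 (by rw [h2, one_mul])
    rcases eq_or_swap_of_add_eq_add hw₁ hw₂ hn1 hn2 hs hne with ⟨e1, e2⟩ | ⟨e1, e2⟩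
    · exact ⟨1, Or.inl rfl, Or.inl (by rw [e1, e2, h₃])⟩
    · exact ⟨-1, Or.inr rfl, Or.inl (by rw [e1, e2, h₃, neg_neg, hmul])⟩
  · have hs : w₁ + w₂ = star (wSign a 1) + star (wSign a (-1)) := by
      rw [← star_add, wSign_add_wSign_neg]
      exact Complex.ext h3 (by rw [h4]; simp)
    have h₃ : w₃ = star (wSign a 1 * wSign a (-1)) := by
      rw [wSign_mul_wSign_neg ha (Or.inl rfl)]
      exact Complex.ext h1 (by rw [h2]; simp)
    have hne' : star (wSign a 1) + star (wSign a (-1)) ≠ 0 := by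
      rw [← star_add]; exact star_ne_zero.mpr hne
    rcases eq_or_swap_of_add_eq_add hw₁ hw₂ (by rw [norm_star, hn1]) (by rw [norm_star, hn2]) hs
      hne' with ⟨e1, e2⟩ | ⟨e1, e2⟩
    · exact ⟨1, Or.inl rfl, Or.inr (by rw [e1, e2, h₃])⟩
    · exact ⟨-1, Or.inr rfl, Or.inr (by rw [e1, e2, h₃, neg_neg, hmul])⟩

lemma isTripleThree_of_solution {w₁ w₂ w₃ : ℂ} (hw₁ : ‖w₁‖ = 1) (hw₂ : ‖w₂‖ = 1)
    (h : ∃ ε : ℝ, (ε = 1 ∨ ε = -1) ∧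
      ((w₃.re = 1 ∧ w₃.im = 0 ∧ (w₁ + w₂).re = -2 / 3 ∧ (w₁ + w₂).im = ε * (2 * √2 / 3)) ∨
        (w₃.re = 0 ∧ w₃.im = ε ∧ (w₁ + w₂).re = -1 ∧ (w₁ + w₂).im = -ε))) :
    IsTripleThree w₁ w₂ w₃ := by
  have hneg : ‖(-1 : ℂ)‖ = 1 := by simp
  obtain ⟨ε, hε, ⟨h1, h2, h3, h4⟩ | ⟨h1, h2, h3, h4⟩⟩ := h
  · have hε2 : ε ^ 2 = 1 := by rcases hε with rfl | rfl <;> norm_num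
    have e3 : w₃ = 1 := Complex.ext h1 h2
    have hs : w₁ + w₂ = ⟨1 / 3, ε * (2 * √2 / 3)⟩ + -1 :=
      Complex.ext (by rw [h3]; norm_num) (by rw [h4]; simp)
    have hn : ‖(⟨1 / 3, ε * (2 * √2 / 3)⟩ : ℂ)‖ = 1 := by
      rw [← pow_eq_one_iff_of_nonneg (norm_nonneg _) two_ne_zero, ← Complex.normSq_eq_norm_sq,
        Complex.normSq_mk]
      have hsq := Real.sq_sqrt (show (0 : ℝ) ≤ 2 by norm_num)
      linear_combination 4 / 9 * ε ^ 2 * hsq + 8 / 9 * hε2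
    have hne : (⟨1 / 3, ε * (2 * √2 / 3)⟩ : ℂ) + -1 ≠ 0 := by
      intro h
      have := congrArg Complex.re h
      norm_num at this
    refine ⟨ε, by rcases hε with rfl | rfl <;> simp, ?_⟩
    rw [one_add_two_sqrt_two_eq, e3]
    rcases eq_or_swap_of_add_eq_add hw₁ hw₂ hn hneg hs hne with ⟨e1, e2⟩ | ⟨e1, e2⟩
    · exact Or.inl (by rw [e1, e2])
    · exact Or.inr (Or.inl (by rw [e1, e2]))
  · -- here `w₃ = ε i`, and the sign in the triple is `-ε`
    have e3 : w₃ = -⟨0, -ε⟩ := Complex.ext (by rw [h1]; simp) (by rw [h2]; simp)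
    have hs : w₁ + w₂ = ⟨0, -ε⟩ + -1 := Complex.ext (by rw [h3]; simp) (by rw [h4]; simp)
    have hn : ‖(⟨0, -ε⟩ : ℂ)‖ = 1 := by
      rw [← pow_eq_one_iff_of_nonneg (norm_nonneg _) two_ne_zero, ← Complex.normSq_eq_norm_sq,
        Complex.normSq_mk]
      rcases hε with rfl | rfl <;> norm_num
    have hne : (⟨0, -ε⟩ : ℂ) + -1 ≠ 0 := by
      intro h
      have := congrArg Complex.re h
      norm_num at this
    refine ⟨((-ε : ℝ) : ℂ), by rcases hε with rfl | rfl <;> simp, ?_⟩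
    rw [mul_I_eq, e3]
    rcases eq_or_swap_of_add_eq_add hw₁ hw₂ hn hneg hs hne with ⟨e1, e2⟩ | ⟨e1, e2⟩
    · exact Or.inr (Or.inr (Or.inl (by rw [e1, e2])))
    · exact Or.inr (Or.inr (Or.inr (by rw [e1, e2])))

end AssociationScheme

open AssociationScheme in
theorem r_eq_zero_of_eigenvalueEquations {X : Type*} [Fintype X] [DecidableEq X]
    {S : AssociationScheme X 3} (h₁₂ : ∀ x y, S.color x y = 1 ↔ S.color y x = 2)
    {k₁ k₂ : ℕ} {r s ν : ℤ} {b : ℝ} (hb : 0 < b)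
    (hP : S.IsFirstEigenmatrix (nonsymmEigenmatrix k₁ k₂ r s b))
    (hF : IsFeasible k₁ k₂ r s ν b) {x w : ℂ} (hw : ‖w‖ = 1)
    (hG : GramEquations (k₁ : ℤ) (k₂ : ℤ) r s ν (x.re ^ 2 + x.im ^ 2) x.re
      (w.re * x.re + w.im * x.im) w.re) : r = 0 := by
  have hX : 0 ≤ x.re ^ 2 + x.im ^ 2 := by positivity
  have hp : x.re ^ 2 ≤ x.re ^ 2 + x.im ^ 2 := by linarith [sq_nonneg x.im]
  have hz : -1 ≤ w.re := by
    have := (abs_le.mp (Complex.abs_re_le_norm w)).1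
    rwa [hw] at this
  have h1 := hF.r_ne_neg_one hG hX
  have h2 := hF.r_lt_one hG hX hp
  by_contra hr
  obtain ⟨e1, e2, rfl, rfl, rfl⟩ := hF.eq_clebsch_of_r_lt hG hX hp hz (by omega) hb
  obtain rfl : k₁ = 10 := by exact_mod_cast e1
  obtain rfl : k₂ = 5 := by exact_mod_cast e2
  exact S.not_isFirstEigenmatrix_clebsch h₁₂ hP

open AssociationScheme in
theorem theorem1 {X : Type*} [Fintype X] [DecidableEq X] (S : AssociationScheme X 3)
    (h₁₂ : ∀ x y, S.color x y = 1 ↔ S.color y x = 2)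
    (h₃ : ∀ x y, S.color x y = 3 ↔ S.color y x = 3)
    (k₁ k₂ : ℕ) (r s : ℤ) (b : ℝ) (hk₁ : 0 < k₁) (hk₁even : Even k₁) (hb : 0 < b)
    (hP : S.IsFirstEigenmatrix (nonsymmEigenmatrix k₁ k₂ r s b))
    (w₁ w₂ w₃ : ℂ) (hw₁ : ‖w₁‖ = 1) (hw₂ : ‖w₂‖ = 1) (hw₃ : ‖w₃‖ = 1) (hw : w₁ ≠ w₂) :
    (IsComplexHadamard (S.adj 0 + w₁ • S.adj 1 + w₂ • S.adj 2 + w₃ • S.adj 3) ↔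
      ∃ a c : ℕ, 0 < a ∧ 0 < c ∧
        (k₁ : ℤ) = 2 * a * (2 * a - 1) * c ∧ (k₂ : ℤ) = 2 * a - 1 ∧ r = 0 ∧ s = -2 * a ∧
        b = 2 * a * Real.sqrt c ∧
        ((c = 1 ∧ IsTripleOne a w₁ w₂ w₃) ∨ (a = 1 ∧ c = 3 ∧ IsTripleThree w₁ w₂ w₃))) ∧
    (r = -((k₂ : ℤ) + 1) → s = 0 → b ^ 2 = ((k₂ : ℝ) + 1) * (k₁ + k₂ + 1) →
      ¬ IsComplexHadamard (S.adj 0 + w₁ • S.adj 1 + w₂ • S.adj 2 + w₃ • S.adj 3)) ∧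
    (r = -1 → s = (k₁ : ℤ) → b ^ 2 = (k₁ : ℝ) + 1 →
      ¬ IsComplexHadamard (S.adj 0 + w₁ • S.adj 1 + w₂ • S.adj 2 + w₃ • S.adj 3)) := by
  rw [isComplexHadamard_iff h₁₂ h₃ hP hw₁ hw₂ hw₃]
  obtain ⟨ν, hF⟩ := isFeasible_of_nonsymmEigenmatrix h₁₂ h₃ hk₁ hb hP
  have hG : EigenvalueEquations k₁ k₂ r s b (w₁ + w₂) (w₁ - w₂) w₃ → GramEquations (k₁ : ℤ)
      (k₂ : ℤ) r s ν ((w₁ + w₂).re ^ 2 + (w₁ + w₂).im ^ 2) (w₁ + w₂).re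
      (w₃.re * (w₁ + w₂).re + w₃.im * (w₁ + w₂).im) w₃.re :=
    fun h => gramEquations hb hF hw₁ hw₂ hw₃ hw (by simpa using h)
  have hr : EigenvalueEquations k₁ k₂ r s b (w₁ + w₂) (w₁ - w₂) w₃ → r = 0 :=
    fun h => r_eq_zero_of_eigenvalueEquations h₁₂ hb hP hF hw₃ (hG h)
  refine ⟨⟨fun h => ?_, ?_⟩, fun h1 _ _ h => ?_, fun h1 _ _ h => ?_⟩
  · obtain rfl := hr h
    obtain ⟨a, c, ha, hc, e1, e2, rfl, rfl, rfl⟩ := exists_multipartite_parameters hb hP hF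
    obtain ⟨g1, g2, g3⟩ := hG h
    have e1R : (((k₁ : ℤ)) : ℝ) = 2 * a * (2 * a - 1) * c := by exact_mod_cast e1
    have e2R : (((k₂ : ℤ)) : ℝ) = 2 * a - 1 := by exact_mod_cast e2
    rw [e1R, e2R] at g2
    rw [e2R] at g3
    push_cast at g1 g2 g3
    have hsq : ∀ {v : ℂ}, ‖v‖ = 1 → v.re ^ 2 + v.im ^ 2 = 1 := by
      intro v hv
      rw [sq, sq, ← Complex.normSq_apply, Complex.normSq_eq_norm_sq, hv, one_pow]
    have hX4 : (w₁ + w₂).re ^ 2 + (w₁ + w₂).im ^ 2 < 4 := by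
      have hsum : (w₁ + w₂).re ^ 2 + (w₁ + w₂).im ^ 2 + Complex.normSq (w₁ - w₂) = 4 := by
        rw [Complex.normSq_apply]
        simp; linear_combination 2 * hsq hw₁ + 2 * hsq hw₂
      have := Complex.normSq_pos.mpr (sub_ne_zero.mpr hw)
      linarith
    have hz : w₃.re ≤ 1 := by
      have := (abs_le.mp (Complex.abs_re_le_norm w₃)).2
      rwa [hw₃] at this
    have haR : (0 : ℝ) < a := by exact_mod_cast ha
    have hp : (w₁ + w₂).re = w₃.re * (w₁ + w₂).re + w₃.im * (w₁ + w₂).im := by linarith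
    rw [← hp] at g2
    have q1 : ((w₁ + w₂).re ^ 2 + (w₁ + w₂).im ^ 2) * ((2 * a - 1) * c - 1) =
        -4 * (w₁ + w₂).re := by
      apply mul_left_cancel₀ haR.ne'
      linarith
    have q3 : a ^ 2 * c * ((w₁ + w₂).re ^ 2 + (w₁ + w₂).im ^ 2) =
        2 - 2 * w₃.re + 2 * a * (c - 1) := by
      linarith
    refine ⟨a, c, ha, hc.pos, e1, e2, rfl, rfl, rfl, ?_⟩
    rcases multipartite_bound ha hc hz q1 q3 with rfl | ⟨rfl, rfl⟩
    · push_cast at q1 q3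
      exact Or.inl ⟨rfl, isTripleOne_of_solution ha hw₁ hw₂
        (solve_multipartite_one ha (hsq hw₃) hX4 hp (by linarith) (by linarith))⟩
    · push_cast at q1 q3
      exact Or.inr ⟨rfl, rfl, isTripleThree_of_solution hw₁ hw₂
        (solve_multipartite_three (hsq hw₃) hp (by linarith) (by linarith))⟩
  · rintro ⟨a, c, ha, -, e1, e2, rfl, rfl, rfl, h⟩
    have e1R : (k₁ : ℝ) = 2 * a * (2 * a - 1) * c := by exact_mod_cast e1
    have e2R : (k₂ : ℝ) = 2 * a - 1 := by exact_mod_cast e2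
    rcases h with ⟨rfl, h⟩ | ⟨rfl, rfl, h⟩
    · have := eigenvalueEquations_of_isTripleOne ha h
      simpa [e1R, e2R] using this
    · have := eigenvalueEquations_of_isTripleThree h
      have e1R' : (k₁ : ℝ) = 6 := by rw [e1R]; norm_num
      have e2R' : (k₂ : ℝ) = 1 := by rw [e2R]; norm_num
      simpa [e1R', e2R'] using this
  · have := hr h
    omega
  · have := hr h
    omega
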